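/- **Definitions.** A ReLU network $\Phi$ with $n_0$-dimensional input and $n_L$-dimensional output is a finite sequence $((W_1,b_1),\dots,(W_L,b_L))$, $L\ge 1$, with $W_i\in\mathbb{R}^{n_i\times n_{i-1}}$, $b_i\in\mathbb{R}^{n_i}$. Its realization is $R(\Phi)(x)=x_L$, where $x_0=x$, $x_i=\max\{0,W_ix_{i-1}+b_i\}$ (componentwise) for $1\le i<L$, and $x_L=W_Lx_{L-1}+b_L$. We write $L(\Phi)=L$ for the number of layers and $M(\Phi)=\sum_{i=1}^{L}(\|W_i\|_0+\|b_i\|_0)$ for the number of nonzero parameters. For $v\in\mathbb{R}^{nk}$, $\mathrm{matr}(v)\in\mathbb{R}^{n\times k}$ is the matrix whose columns, stacked one below the other, give $v$. $\|\cdot\|_2$ is the spectral norm. **Setting.** Let $p,N,N_I,n$ be natural numbers with $N,n\ge 1$ and $N_I\le N$, let $\mathcal D\subset\mathbb{R}^p$, let $\mu\mapsto L(\mu)\in\mathbb{R}^{N_I\times N}$ be a matrix-valued map on $\mathbb{R}^p$ (the stiffness matrix; only its values on $\mathcal D$ matter), and let $V\in\mathbb{R}^{N\times n}$ (the reduced basis,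 $n=n_{\mathrm{POD}}$; any matrix is allowed). Put $$B_\mu=\begin{bmatrix} L(\mu)\\ \begin{array}{c|c}\mathbf 0& I_{N-N_I}\end{array}\end{bmatrix}V\in\mathbb{R}^{N\times n}.$$ Let $0<\beta<\alpha$ and suppose: 1. for all $\mu\in\mathcal D$, the spectrum of $B_\mu^TB_\mu$ is contained in $[\beta^2,\alpha^2]$; 2. for every $\eta>0$ there is a ReLU network $\Phi^B_{V,\eta}$ with $p$-dimensional input and $Nn$-dimensional output such that $\sup_{\mu\in\mathcal D}\|B_\mu-\mathrm{matr}(R(\Phi^B_{V,\eta})(\mu))\|_2\le\eta$. Fix any such choice and set $L(B;V,\eta)=L(\Phi^B_{V,\eta})$, $M(B;V,\eta)=M(\Phi^B_{V,\eta})$. **Proposition.** There are constants $C_L,C_M>0$ depending only on $\alpha$ and $\beta$ such that, in every such setting and for every $\varepsilon\in(0,1/4)$, there is a ReLU network $\Phi$ with $p$-dimensional input and $n^2$-dimensional output satisfying all of the following: 1. $\displaystyle\sup_{\mu\in\mathcal D}\bigl\|(B_\mu^TB_\mu)^{-1}-\mathrm{matr}(R(\Phi)(\mu))\bigr\|_2\le\varepsilon$;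 2. $L(\Phi)\le C_L\,\log_2(\log_2(1/\varepsilon))\,(\log_2(1/\varepsilon)+\log_2 n)+C_L\log_2N+L(B;V,\varepsilon_1)$; 3. $M(\Phi)\le C_M\,n^2\log_2(1/\varepsilon)\,(\log_2(\log_2(1/\varepsilon))+n)\,(\log_2(1/\varepsilon)+\log_2 n)+C_M\,N n^2(\log_2(1/\varepsilon)+\log_2N)+8M(B;V,\varepsilon_1)$, where $\displaystyle\varepsilon_1=\min\Bigl\{\frac{\varepsilon\beta^4}{24\alpha},\frac{\beta^2\sqrt\varepsilon}{4},\frac{\beta^2}{12\alpha},\frac{\beta}{3}\Bigr\}.$ -/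

import Mathlib

open scoped Matrix Matrix.Norms.L2Operator

noncomputable section

/-- A ReLU neural network with `n₀`-dimensional input and `n_L`-dimensional output: a finite nonempty
sequence `((W₁, b₁), …, (W_L, b_L))` of weight matrices `Wᵢ ∈ ℝ^{nᵢ × nᵢ₋₁}` and bias vectors
`bᵢ ∈ ℝ^{nᵢ}`.  `output W b` is a sequence of length one, `hidden W b Φ` puts the layer `(W, b)`
in front of the network `Φ`.  Hidden layers have positive width. -/
inductive ReLUNetwork : ℕ → ℕ → Type
  | output {m n : ℕ} (W : Matrix (Fin n) (Fin m) ℝ) (b : Fin n → ℝ) : ReLUNetwork m n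
  | hidden {m k n : ℕ} (hk : 0 < k) (W : Matrix (Fin k) (Fin m) ℝ) (b : Fin k → ℝ)
      (Φ : ReLUNetwork k n) : ReLUNetwork m n

namespace ReLUNetwork

/-- The realization `R(Φ) : ℝ^{n₀} → ℝ^{n_L}`: every layer is affine, and it is followed by the
componentwise activation `x ↦ max {0, x}` in all layers but the last. -/
def realize : {m n : ℕ} → ReLUNetwork m n → (Fin m → ℝ) → (Fin n → ℝ)
  | _, _, output W b, x => W *ᵥ x + b
  | _, _, hidden _ W b Φ, x => Φ.realize (fun i => max 0 ((W *ᵥ x + b) i))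

/-- The number of layers `L(Φ)`. -/
def numLayers : {m n : ℕ} → ReLUNetwork m n → ℕ
  | _, _, output _ _ => 1
  | _, _, hidden _ _ _ Φ => 1 + Φ.numLayers

/-- The number `‖W‖₀ + ‖b‖₀` of nonzero parameters of one layer. -/
def layerParams {m n : ℕ} (W : Matrix (Fin n) (Fin m) ℝ) (b : Fin n → ℝ) : ℕ :=
  (∑ i, hammingNorm (W i)) + hammingNorm b

/-- The total number `M(Φ)` of nonzero parameters. -/
def numParams : {m n : ℕ} → ReLUNetwork m n → ℕ
  | _, _, output W b => layerParams W b
  | _, _, hidden _ W b Φ => layerParams W b + Φ.numParams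

end ReLUNetwork

/-- `matr v ∈ ℝ^{n × k}` for `v ∈ ℝ^{nk}`, the columns of the matrix being stacked in `v`:
the entry `(i, j)` (counted from zero) is the coordinate of `v` with number `i + n j`. -/
def matr {n k : ℕ} (v : Fin (k * n) → ℝ) : Matrix (Fin n) (Fin k) ℝ :=
  Matrix.of fun i j => v (finProdFinEquiv (j, i))

/-- The `N × N` matrix of the discretized boundary value problem: its first `N_I` rows (interior
nodes) are those of the stiffness matrix `L ∈ ℝ^{N_I × N}`, and its last `N - N_I` rows (boundary
nodes) are `(0 | I)`. -/
def systemMatrix {N NI : ℕ} (L : Matrix (Fin NI) (Fin N) ℝ) : Matrix (Fin N) (Fin N) ℝ :=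
  Matrix.of fun i j => if h : (i : ℕ) < NI then L ⟨i, h⟩ j else if i = j then 1 else 0

/-- The matrix `B_μ ∈ ℝ^{N × n}` of the reduced system: its columns are the system matrix at the
parameter `μ` applied to the columns of the reduced basis `V`. -/
def reducedMatrix {p N NI n : ℕ} (L : (Fin p → ℝ) → Matrix (Fin NI) (Fin N) ℝ)
    (V : Matrix (Fin N) (Fin n) ℝ) (μ : Fin p → ℝ) : Matrix (Fin N) (Fin n) ℝ :=
  systemMatrix (L μ) * V

/-- For all `μ ∈ D` the spectrum of `B_μᵀ B_μ` lies in `[β², α²]`. -/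
def SpectrumAssumption {p N n : ℕ} (α β : ℝ) (D : Set (Fin p → ℝ))
    (B : (Fin p → ℝ) → Matrix (Fin N) (Fin n) ℝ) : Prop :=
  ∀ μ ∈ D, spectrum ℝ ((B μ)ᵀ * B μ) ⊆ Set.Icc (β ^ 2) (α ^ 2)

/-- For every `ε > 0` the network `Φ ε` approximates `μ ↦ A_μ` on `D` up to `ε` in the
spectral norm. -/
def ReLUApproximates {p N n : ℕ} (D : Set (Fin p → ℝ))
    (A : (Fin p → ℝ) → Matrix (Fin N) (Fin n) ℝ) (Φ : ℝ → ReLUNetwork p (n * N)) : Prop :=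
  ∀ ε : ℝ, 0 < ε → ∀ μ ∈ D, ‖A μ - matr ((Φ ε).realize μ)‖ ≤ ε

/-- The accuracy at which the size of the networks for `μ ↦ B_μ` enters. -/
def innerAccuracy (α β ε : ℝ) : ℝ :=
  min (min (ε * β ^ 4 / (24 * α)) (β ^ 2 * √ε / 4)) (min (β ^ 2 / (12 * α)) (β / 3))

end

/-! The inverse of A = BᵀB is computed by the Newton–Schulz iteration X ↦ X(2 − AX). The residual
satisfies 1 − AX(2 − AX) = (1 − AX)², with no commutation needed, so perturbed steps still square it
up to a small error (`newton_residual_le`). Starting from X = s·1 with s = 1/(α² + β²), the residual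
is below a constant q < 1 depending only on α and β. A bounded number of steps brings it below 1/4,
and then about log₂ log₂(1/ε) steps bring it to order ε (`exists_newton_steps`). This is the source
of the double logarithm.

Each step consists of two matrix products, hence 2n³ scalar products. A scalar product is a
combination of squares, and a ReLU network of depth m + 1 computes squares on [0, 1] up to 4⁻ᵐ/4 by
summing sawtooth functions (`sqApprox_sub_sq_mem`, `abs_mulApprox_sub_le`). Depth of order log₂(1/ε)
+ log₂ n suffices per product (`exists_depth`). The multiplication needs a fixed bound Z on its
factors; it persists because a residual of norm at most 1 bounds the iterate
(`norm_le_of_residual`).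

The matrix fed to the iteration is only an approximate Gram matrix of an approximate B. It need not
be symmetric or inverted: its distance to A enters the final error linearly (`norm_inv_sub_le`). -/

/-! ### Affine maps with few nonzero coefficients -/

/-- `g` is an affine combination of the coordinates of `F` in which at most `c` of the coefficients
and the constant term are nonzero. -/
def SparseAffine {X κ : Type} [Fintype κ] (F : X → κ → ℝ) (c : ℕ) (g : X → ℝ) : Prop :=
  ∃ (w : κ → ℝ) (b : ℝ), hammingNorm w + (if b ≠ 0 then 1 else 0) ≤ c ∧
    ∀ x, g x = ∑ i, w i * F x i + b

section Hamming

variable {κ : Type} [Fintype κ]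

theorem hammingNorm_add_le (w w' : κ → ℝ) :
    hammingNorm (w + w') ≤ hammingNorm w + hammingNorm w' := by
  classical
  refine le_trans (Finset.card_le_card ?_) (Finset.card_union_le _ _)
  intro i
  simp only [Finset.mem_filter, Finset.mem_union, Finset.mem_univ, true_and, Pi.add_apply]
  contrapose!
  rintro ⟨h, h'⟩
  simp [h, h']

theorem hammingNorm_single_le [DecidableEq κ] (i : κ) (a : ℝ) :
    hammingNorm (Pi.single i a : κ → ℝ) ≤ 1 := by
  rw [← Finset.card_singleton i]
  refine Finset.card_le_card fun j => ?_
  simp only [Finset.mem_filter, Finset.mem_univ, true_and, Finset.mem_singleton]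
  contrapose!
  exact fun h => Pi.single_eq_of_ne h _

theorem hammingNorm_comp_equiv {κ' : Type} [Fintype κ'] (e : κ' ≃ κ) (w : κ → ℝ) :
    hammingNorm (fun i => w (e i)) = hammingNorm w := by
  refine Finset.card_bij (fun i _ => e i) (by simp) (by simp) fun i hi => ⟨e.symm i, ?_⟩
  simpa using hi

theorem hammingNorm_eq_sum (w : κ → ℝ) : hammingNorm w = ∑ i, if w i ≠ 0 then 1 else 0 := by
  rw [hammingNorm, Finset.card_filter]

end Hamming

namespace SparseAffine

variable {X κ : Type} [Fintype κ] {F : X → κ → ℝ}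

theorem mono {c c' : ℕ} {g : X → ℝ} (h : SparseAffine F c g) (hc : c ≤ c') :
    SparseAffine F c' g := by
  obtain ⟨w, b, h₁, h₂⟩ := h
  exact ⟨w, b, h₁.trans hc, h₂⟩

theorem const (F : X → κ → ℝ) (a : ℝ) : SparseAffine F 1 fun _ => a := by
  refine ⟨0, a, ?_, by simp⟩
  rw [hammingNorm_zero]
  split_ifs <;> simp

theorem zero (F : X → κ → ℝ) : SparseAffine F 0 fun _ => 0 :=
  ⟨0, 0, by simp, by simp⟩

theorem coord (F : X → κ → ℝ) (i : κ) : SparseAffine F 1 fun x => F x i := by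
  classical
  refine ⟨Pi.single i 1, 0, by simpa using hammingNorm_single_le i 1, fun x => ?_⟩
  simp [Pi.single_apply]

theorem add {c c' : ℕ} {g g' : X → ℝ} (h : SparseAffine F c g) (h' : SparseAffine F c' g') :
    SparseAffine F (c + c') fun x => g x + g' x := by
  obtain ⟨w, b, h₁, h₂⟩ := h
  obtain ⟨w', b', h₁', h₂'⟩ := h'
  refine ⟨w + w', b + b', ?_, fun x => ?_⟩
  · have := hammingNorm_add_le w w'
    have hb : (if b + b' ≠ 0 then 1 else 0) ≤
        (if b ≠ 0 then 1 else 0) + (if b' ≠ 0 then 1 else 0) := by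
      by_cases hb : b = 0 <;> by_cases hb' : b' = 0 <;> simp [hb, hb']
      split_ifs <;> omega
    omega
  · simp only [h₂, h₂']
    simp only [Pi.add_apply, add_mul, Finset.sum_add_distrib]
    ring

theorem const_mul {c : ℕ} {g : X → ℝ} (h : SparseAffine F c g) (a : ℝ) :
    SparseAffine F c fun x => a * g x := by
  obtain ⟨w, b, h₁, h₂⟩ := h
  refine ⟨a • w, a * b, le_trans (add_le_add (Finset.card_le_card ?_) ?_) h₁, fun x => ?_⟩
  · intro i
    simp only [Finset.mem_filter, Finset.mem_univ, true_and, Pi.smul_apply, smul_eq_mul]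
    contrapose!
    intro h
    simp [h]
  · by_cases hb : b = 0
    · simp [hb]
    · simp only [hb, ne_eq, not_false_eq_true, if_true]
      split_ifs <;> simp
  · simp only [h₂, mul_add, Finset.mul_sum]
    simp [mul_assoc]

theorem neg {c : ℕ} {g : X → ℝ} (h : SparseAffine F c g) : SparseAffine F c fun x => -g x := by
  simpa using h.const_mul (-1)

theorem sub {c c' : ℕ} {g g' : X → ℝ} (h : SparseAffine F c g) (h' : SparseAffine F c' g') :
    SparseAffine F (c + c') fun x => g x - g' x := by
  simpa [sub_eq_add_neg] using h.add h'.neg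

theorem sum {ι : Type} (s : Finset ι) {c : ℕ} {g : ι → X → ℝ}
    (h : ∀ i ∈ s, SparseAffine F c (g i)) :
    SparseAffine F (s.card * c) fun x => ∑ i ∈ s, g i x := by
  classical
  induction s using Finset.induction_on with
  | empty => simpa using zero F
  | insert a s ha ih =>
    simp only [Finset.sum_insert ha, Finset.card_insert_of_notMem ha]
    have h₁ := h a (Finset.mem_insert_self a s)
    have h₂ := ih fun i hi => h i (Finset.mem_insert_of_mem hi)
    exact (h₁.add h₂).mono (by ring_nf; omega)

end SparseAffine

/-! ### Building networks layer by layer -/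

namespace ReLUNetwork

/-- The values `F` are the activations after `ℓ` hidden layers with at most `M` nonzero parameters
in total: every network acting on `F` extends to one acting on the input. -/
def ReachedByHidden {p : ℕ} {D : Set (Fin p → ℝ)} {κ : Type} [Fintype κ] (F : D → κ → ℝ)
    (ℓ M : ℕ) : Prop :=
  ∀ (r : ℕ) (Ψ : ReLUNetwork (Fintype.card κ) r), ∃ Φ : ReLUNetwork p r,
    Φ.numLayers = ℓ + Ψ.numLayers ∧ Φ.numParams ≤ M + Ψ.numParams ∧
    ∀ x : D, Φ.realize x = Ψ.realize fun i => F x ((Fintype.equivFin κ).symm i)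

variable {p : ℕ} {D : Set (Fin p → ℝ)} {κ κ' : Type} [Fintype κ]

theorem exists_layer {F : D → κ → ℝ} {g : D → κ' → ℝ} {c : ℕ}
    (hg : ∀ k, SparseAffine F c fun x => g x k) {k : ℕ} (e : Fin k ≃ κ') :
    ∃ (W : Matrix (Fin k) (Fin (Fintype.card κ)) ℝ) (b : Fin k → ℝ),
      layerParams W b ≤ c * k ∧
      ∀ x, W *ᵥ (fun i => F x ((Fintype.equivFin κ).symm i)) + b = fun i => g x (e i) := by
  choose w b hwb hw using hg
  refine ⟨Matrix.of fun i j => w (e i) ((Fintype.equivFin κ).symm j), fun i => b (e i), ?_, ?_⟩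
  · rw [layerParams, hammingNorm_eq_sum, ← Finset.sum_add_distrib]
    calc _ ≤ ∑ _i : Fin k, c := Finset.sum_le_sum fun i _ => ?_
      _ = c * k := by simp [mul_comm]
    have := hammingNorm_comp_equiv (Fintype.equivFin κ).symm (w (e i))
    refine le_trans (le_of_eq ?_) (hwb (e i))
    rw [← this]
    rfl
  · intro x
    ext i
    rw [show g x (e i) = _ from hw (e i) x]
    simp only [Pi.add_apply, Matrix.mulVec, dotProduct, Matrix.of_apply]
    congr 1
    exact Equiv.sum_comp (Fintype.equivFin κ).symm fun j => w (e i) j * F x j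

namespace ReachedByHidden

theorem mono {F : D → κ → ℝ} {ℓ M M' : ℕ} (h : ReachedByHidden F ℓ M) (hM : M ≤ M') :
    ReachedByHidden F ℓ M' := by
  intro r Ψ
  obtain ⟨Φ, h₁, h₂, h₃⟩ := h r Ψ
  exact ⟨Φ, h₁, by omega, h₃⟩

theorem layer [Fintype κ'] [Nonempty κ'] {F : D → κ → ℝ} {ℓ M c : ℕ} (h : ReachedByHidden F ℓ M)
    {g : D → κ' → ℝ} (hg : ∀ k, SparseAffine F c fun x => g x k) :
    ReachedByHidden (fun x k => max 0 (g x k)) (ℓ + 1) (M + c * Fintype.card κ') := by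
  intro r Ψ
  obtain ⟨W, b, hWb, hW⟩ := exists_layer hg (Fintype.equivFin κ').symm
  obtain ⟨Φ, h₁, h₂, h₃⟩ := h r (hidden Fintype.card_pos W b Ψ)
  refine ⟨Φ, by rw [h₁, numLayers]; ring, ?_, fun x => ?_⟩
  · rw [numParams] at h₂
    omega
  · rw [h₃, realize, hW]

theorem output {F : D → κ → ℝ} {ℓ M c r : ℕ} (h : ReachedByHidden F ℓ M)
    {g : D → Fin r → ℝ} (hg : ∀ k, SparseAffine F c fun x => g x k) :
    ∃ Φ : ReLUNetwork p r, Φ.numLayers = ℓ + 1 ∧ Φ.numParams ≤ M + c * r ∧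
      ∀ x : D, Φ.realize x = g x := by
  obtain ⟨W, b, hWb, hW⟩ := exists_layer hg (Equiv.refl _)
  obtain ⟨Φ, h₁, h₂, h₃⟩ := h r (ReLUNetwork.output W b)
  refine ⟨Φ, by rw [h₁, numLayers], ?_, fun x => ?_⟩
  · rw [numParams] at h₂
    omega
  · rw [h₃, realize, hW]
    rfl

end ReachedByHidden

/-- The positive and negative parts of the coordinates of `y`. -/
def signParts {X ι : Type} (y : X → ι → ℝ) (x : X) (i : ι × Bool) : ℝ :=
  max 0 (if i.2 then y x i.1 else -y x i.1)

theorem signParts_nonneg {X ι : Type} (y : X → ι → ℝ) (x : X) (i : ι × Bool) :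
    0 ≤ signParts y x i := le_max_left _ _

theorem signParts_sub {X ι : Type} (y : X → ι → ℝ) (x : X) (i : ι) :
    signParts y x (i, true) - signParts y x (i, false) = y x i := by
  simp only [signParts, if_true, Bool.false_eq_true, if_false]
  rcases le_total 0 (y x i) with h | h
  · rw [max_eq_right h, max_eq_left (by linarith), sub_zero]
  · rw [max_eq_left h, max_eq_right (by linarith)]
    ring

/-- Signed values pass through the activation as pairs of nonnegative parts; reading one back costs
two coefficients. -/
theorem sparseAffine_signParts {X ι : Type} [Fintype ι] (y : X → ι → ℝ) (i : ι) :
    SparseAffine (signParts y) 2 fun x => y x i := by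
  simpa [signParts_sub] using
    (SparseAffine.coord (signParts y) (i, true)).sub (SparseAffine.coord (signParts y) (i, false))

theorem ReachedByHidden.signLayer {ι : Type} [Fintype ι] [Nonempty ι] {F : D → κ → ℝ}
    {ℓ M c : ℕ} (h : ReachedByHidden F ℓ M) {y : D → ι → ℝ}
    (hy : ∀ i, SparseAffine F c fun x => y x i) :
    ReachedByHidden (signParts y) (ℓ + 1) (M + c * (Fintype.card ι * 2)) := by
  have := h.layer (κ' := ι × Bool) (g := fun x i => if i.2 then y x i.1 else -y x i.1) (c := c) (by
    rintro ⟨i, _ | _⟩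
    · simpa using (hy i).neg
    · simpa using hy i)
  rwa [Fintype.card_prod, Fintype.card_bool] at this

/-- A network can be continued after its output has been split into positive and negative
parts. -/
theorem exists_append {m n : ℕ} (hn : 0 < n) (Φ : ReLUNetwork m n) {r : ℕ}
    (Ψ : ReLUNetwork (Fintype.card (Fin n × Bool)) r) :
    ∃ Φ' : ReLUNetwork m r, Φ'.numLayers = Φ.numLayers + Ψ.numLayers ∧
      Φ'.numParams ≤ 2 * Φ.numParams + Ψ.numParams ∧
      ∀ x, Φ'.realize x = Ψ.realize fun i =>
        signParts Φ.realize x ((Fintype.equivFin (Fin n × Bool)).symm i) := by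
  induction Φ with
  | @output m n W b =>
    -- Only the output layer is duplicated, with both signs. Since affine maps are never composed,
    -- no product of weight matrices can fill in zeros.
    let W' : Matrix (Fin n × Bool) (Fin m) ℝ := fun i => if i.2 then W i.1 else -W i.1
    let b' : Fin n × Bool → ℝ := fun i => if i.2 then b i.1 else -b i.1
    have : Nonempty (Fin n × Bool) := ⟨(⟨0, hn⟩, true)⟩
    refine ⟨hidden (Fintype.card_pos (α := Fin n × Bool))
      (Matrix.of fun i => W' ((Fintype.equivFin (Fin n × Bool)).symm i))
      (fun i => b' ((Fintype.equivFin (Fin n × Bool)).symm i)) Ψ, rfl, ?_, fun x => ?_⟩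
    · simp only [numParams]
      refine add_le_add_left (le_of_eq ?_) _
      simp only [layerParams, hammingNorm_eq_sum b, hammingNorm_eq_sum (κ := Fin _) fun i => b' _]
      rw [mul_add]
      congr 1
      · refine (Equiv.sum_comp (Fintype.equivFin (Fin n × Bool)).symm
          (fun i => hammingNorm (W' i))).trans ?_
        rw [Fintype.sum_prod_type, Finset.mul_sum]
        refine Finset.sum_congr rfl fun i _ => ?_
        have : hammingNorm (-W i) = hammingNorm (W i) := by simp [hammingNorm]
        simp [W', this, two_mul]
      · refine (Equiv.sum_comp (Fintype.equivFin (Fin n × Bool)).symm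
          (fun i => if b' i ≠ 0 then 1 else 0)).trans ?_
        rw [Fintype.sum_prod_type, Finset.mul_sum]
        refine Finset.sum_congr rfl fun i _ => ?_
        by_cases h : b i = 0 <;> simp [b', h]
    · simp only [realize]
      congr 1
      ext i
      simp only [signParts, Pi.add_apply, Matrix.mulVec, Matrix.of_apply, W', b']
      split_ifs
      · rfl
      · simp only [neg_dotProduct]
        congr 1
        ring
  | hidden hk W b Φ ih =>
    obtain ⟨Φ', h₁, h₂, h₃⟩ := ih hn Ψ
    refine ⟨hidden hk W b Φ', ?_, ?_, fun x => ?_⟩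
    · simp only [numLayers, h₁]
      ring
    · simp only [numParams]
      omega
    · simp only [realize, h₃]
      rfl

theorem ReachedByHidden.of_network {n : ℕ} (hn : 0 < n) (Φ : ReLUNetwork p n) :
    ReachedByHidden (D := D) (signParts fun x => Φ.realize x) Φ.numLayers (2 * Φ.numParams) := by
  intro r Ψ
  obtain ⟨Φ', h₁, h₂, h₃⟩ := exists_append hn Φ Ψ
  exact ⟨Φ', h₁, h₂, fun x => h₃ x⟩

end ReLUNetwork

/-! ### Squaring and multiplication by ReLU networks -/

namespace ReLUNetwork

/-- The tooth function, which on `[0, 1]` is `t ↦ min (2 t) (2 - 2 t)`. -/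
noncomputable def tooth (t : ℝ) : ℝ := 2 * max 0 t - 4 * max 0 (t - 1 / 2)

/-- The iterates of the tooth function. -/
noncomputable def sawtooth (m : ℕ) (t : ℝ) : ℝ := tooth^[m] t

/-- The piecewise linear interpolation of `t ↦ t²` on `[0, 1]` at the multiples of `2⁻ᵐ`. -/
noncomputable def sqApprox (m : ℕ) (t : ℝ) : ℝ :=
  t - ∑ s ∈ Finset.range m, sawtooth (s + 1) t / 4 ^ (s + 1)

theorem tooth_mem {t : ℝ} (ht : t ∈ Set.Icc (0 : ℝ) 1) : tooth t ∈ Set.Icc (0 : ℝ) 1 := by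
  obtain ⟨h₀, h₁⟩ := ht
  rw [tooth, max_eq_right h₀]
  rcases le_total t (1 / 2) with h | h
  · rw [max_eq_left (by linarith)]
    constructor <;> linarith
  · rw [max_eq_right (by linarith)]
    constructor <;> linarith

/-- This self-similarity of t(1 − t), iterated, expands t − t² into sawtooth functions with an
explicit remainder, four times smaller at each level. -/
theorem mul_one_sub_eq_tooth {t : ℝ} (ht : t ∈ Set.Icc (0 : ℝ) 1) :
    t * (1 - t) = tooth t / 4 + tooth t * (1 - tooth t) / 4 := by
  obtain ⟨h₀, h₁⟩ := ht
  rw [tooth, max_eq_right h₀]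
  rcases le_total t (1 / 2) with h | h
  · rw [max_eq_left (by linarith)]
    ring
  · rw [max_eq_right (by linarith)]
    ring

theorem sawtooth_succ (m : ℕ) (t : ℝ) : sawtooth (m + 1) t = tooth (sawtooth m t) :=
  Function.iterate_succ_apply' _ _ _

theorem sawtooth_mem (m : ℕ) {t : ℝ} (ht : t ∈ Set.Icc (0 : ℝ) 1) :
    sawtooth m t ∈ Set.Icc (0 : ℝ) 1 := by
  induction m with
  | zero => exact ht
  | succ m ih =>
    rw [sawtooth_succ]
    exact tooth_mem ih

theorem sqApprox_succ (m : ℕ) (t : ℝ) :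
    sqApprox (m + 1) t = sqApprox m t - tooth (sawtooth m t) / 4 ^ (m + 1) := by
  rw [sqApprox, Finset.sum_range_succ, sawtooth_succ, sqApprox]
  ring

theorem sqApprox_sub_sq (m : ℕ) {t : ℝ} (ht : t ∈ Set.Icc (0 : ℝ) 1) :
    sqApprox m t - t ^ 2 = sawtooth m t * (1 - sawtooth m t) / 4 ^ m := by
  induction m with
  | zero =>
    simp only [sqApprox, sawtooth, Finset.range_zero, Finset.sum_empty, Function.iterate_zero, id]
    ring
  | succ m ih =>
    rw [mul_one_sub_eq_tooth (sawtooth_mem m ht)] at ih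
    rw [sqApprox_succ, sawtooth_succ]
    have : sqApprox m t = t ^ 2 + (tooth (sawtooth m t) / 4 +
      tooth (sawtooth m t) * (1 - tooth (sawtooth m t)) / 4) / 4 ^ m := by linarith
    rw [this, pow_succ]
    field_simp
    ring

theorem sqApprox_sub_sq_mem (m : ℕ) {t : ℝ} (ht : t ∈ Set.Icc (0 : ℝ) 1) :
    sqApprox m t - t ^ 2 ∈ Set.Icc (0 : ℝ) (1 / 4 / 4 ^ m) := by
  rw [sqApprox_sub_sq m ht]
  obtain ⟨h₀, h₁⟩ := sawtooth_mem m ht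
  refine ⟨by have := sub_nonneg.2 h₁; positivity, ?_⟩
  gcongr
  nlinarith [sq_nonneg (sawtooth m t - 1 / 2)]

/-- Nonnegativity lets the activation pass the partial sum unchanged, so one channel suffices for
it. -/
theorem sqApprox_nonneg (m : ℕ) {t : ℝ} (ht : t ∈ Set.Icc (0 : ℝ) 1) : 0 ≤ sqApprox m t := by
  have := (sqApprox_sub_sq_mem m ht).1
  nlinarith [sq_nonneg t]

variable {p : ℕ} {D : Set (Fin p → ℝ)}

/-- The activations of the network computing `sqApprox m` of the coordinates of `u` while keeping
the values `F`. -/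
noncomputable def sqState {τ κ : Type} (u : D → τ → ℝ) (F : D → κ → ℝ) (m : ℕ) (x : D) :
    (τ × Fin 3) ⊕ κ → ℝ :=
  Sum.elim (fun i => ![max 0 (sawtooth m (u x i.1)), max 0 (sawtooth m (u x i.1) - 1 / 2),
    sqApprox m (u x i.1)] i.2) (F x)

/-- The next tooth is an affine function of the first two channels, so each level of the expansion
costs one layer. The values `F` are nonnegative and hence carried along unchanged. -/
theorem ReachedByHidden.sqState {τ κ : Type} [Fintype τ] [Fintype κ] [Nonempty κ]
    {F : D → κ → ℝ} {ℓ M c : ℕ} (h : ReachedByHidden F ℓ M) (hF : ∀ x k, 0 ≤ F x k)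
    {u : D → τ → ℝ} (hu : ∀ x i, u x i ∈ Set.Icc (0 : ℝ) 1) (hc : 3 ≤ c)
    (hs : ∀ i, SparseAffine F c fun x => u x i) (m : ℕ) :
    ReachedByHidden (ReLUNetwork.sqState u F m) (ℓ + (m + 1))
      (M + (c + 1) * (m + 1) * (Fintype.card τ * 3 + Fintype.card κ)) := by
  have hcard : Fintype.card ((τ × Fin 3) ⊕ κ) = Fintype.card τ * 3 + Fintype.card κ := by simp
  induction m with
  | zero =>
    have := h.layer (κ' := (τ × Fin 3) ⊕ κ) (c := c + 1) (g := fun x => Sum.elim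
      (fun i => ![u x i.1, u x i.1 - 1 / 2, u x i.1] i.2) (F x)) ?_
    · rw [hcard] at this
      convert this using 1
      · ext x k
        rcases k with ⟨i, j⟩ | k
        · fin_cases j <;>
            simp [ReLUNetwork.sqState, sawtooth, sqApprox, (hu x i).1]
        · simp [ReLUNetwork.sqState, hF x k]
      · ring
    · rintro (⟨i, j⟩ | k)
      · fin_cases j
        · exact (hs i).mono (by omega)
        · exact (hs i).sub (SparseAffine.const F (1 / 2))
        · exact (hs i).mono (by omega)
      · exact (SparseAffine.coord F k).mono (by omega)
  | succ m ih =>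
    have := ih.layer (κ' := (τ × Fin 3) ⊕ κ) (c := c + 1) (g := fun x => Sum.elim
      (fun i => ![tooth (sawtooth m (u x i.1)), tooth (sawtooth m (u x i.1)) - 1 / 2,
        sqApprox m (u x i.1) - 1 / 4 ^ (m + 1) * tooth (sawtooth m (u x i.1))] i.2) (F x)) ?_
    · rw [hcard] at this
      convert this using 1
      · ext x k
        rcases k with ⟨i, j⟩ | k
        · fin_cases j
          · simp [ReLUNetwork.sqState, sawtooth_succ]
          · simp [ReLUNetwork.sqState, sawtooth_succ]
          · have := sqApprox_nonneg (m + 1) (hu x i)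
            rw [sqApprox_succ] at this
            have e : 1 / 4 ^ (m + 1) * tooth (sawtooth m (u x i)) =
              tooth (sawtooth m (u x i)) / 4 ^ (m + 1) := by ring
            simp only [ReLUNetwork.sqState, sqApprox_succ, Sum.elim_inl, e]
            exact (max_eq_right this).symm
        · simp [ReLUNetwork.sqState, hF x k]
      · ring
      · ring
    · have hg : ∀ i, SparseAffine (ReLUNetwork.sqState u F m) 2
          fun x => tooth (sawtooth m (u x i)) := fun i =>
        ((SparseAffine.coord (ReLUNetwork.sqState u F m) (.inl (i, 0))).const_mul 2).sub
          ((SparseAffine.coord (ReLUNetwork.sqState u F m) (.inl (i, 1))).const_mul 4)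
      rintro (⟨i, j⟩ | k)
      · fin_cases j
        · exact (hg i).mono (by omega)
        · exact ((hg i).sub (SparseAffine.const _ (1 / 2))).mono (by omega)
        · exact ((SparseAffine.coord (ReLUNetwork.sqState u F m) (.inl (i, 2))).sub
            ((hg i).const_mul _)).mono (by omega)
      · exact (SparseAffine.coord (ReLUNetwork.sqState u F m) (.inr k)).mono (by omega)

/-- The arguments of the four squares from which a product `a b` is assembled. -/
noncomputable def squareArg (Z a b : ℝ) (s : Bool × Bool) : ℝ :=
  1 / 2 + (if s.1 then 1 else -1) / (4 * Z) * (a + (if s.2 then 1 else -1) * b)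

/-- The approximation of the product `a b` for `|a|, |b| ≤ Z` assembled from four squares. -/
noncomputable def mulApprox (Z : ℝ) (m : ℕ) (a b : ℝ) : ℝ :=
  ∑ s : Bool × Bool,
    (if s.2 then 1 else -1) * (2 * Z ^ 2) * sqApprox m (squareArg Z a b s)

theorem squareArg_mem {Z a b : ℝ} (hZ : 0 < Z) (ha : |a| ≤ Z) (hb : |b| ≤ Z) (s : Bool × Bool) :
    squareArg Z a b s ∈ Set.Icc (0 : ℝ) 1 := by
  obtain ⟨ha₁, ha₂⟩ := abs_le.1 ha
  obtain ⟨hb₁, hb₂⟩ := abs_le.1 hb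
  have key : ∀ v : ℝ, |v| ≤ 2 * Z → 1 / 2 + v / (4 * Z) ∈ Set.Icc (0 : ℝ) 1 := by
    intro v hv
    have : |v / (4 * Z)| ≤ 1 / 2 := by
      rw [abs_div, abs_of_pos (by positivity : 0 < 4 * Z), div_le_iff₀ (by positivity)]
      linarith
    obtain ⟨h₁, h₂⟩ := abs_le.1 this
    constructor <;> linarith
  obtain ⟨_ | _, _ | _⟩ := s
  · convert key (-(a - b)) (abs_le.2 ⟨by linarith, by linarith⟩) using 1
    simp [squareArg]; ring
  · convert key (-(a + b)) (abs_le.2 ⟨by linarith, by linarith⟩) using 1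
    simp [squareArg]; ring
  · convert key (a - b) (abs_le.2 ⟨by linarith, by linarith⟩) using 1
    simp [squareArg]; ring
  · convert key (a + b) (abs_le.2 ⟨by linarith, by linarith⟩) using 1
    simp [squareArg]; ring

/-- With v = a ± b, the squares of 1/2 + v/(4Z) and 1/2 − v/(4Z) add up to 1/2 + v²/(8Z²);
subtracting the two cases leaves ab/(2Z²). The four errors have one sign before weighting, two enter
positively and two negatively, so at most two accumulate. -/
theorem abs_mulApprox_sub_le {Z a b : ℝ} (hZ : 0 < Z) (ha : |a| ≤ Z) (hb : |b| ≤ Z) (m : ℕ) :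
    |mulApprox Z m a b - a * b| ≤ Z ^ 2 / 4 ^ m := by
  have key : a * b = ∑ s : Bool × Bool,
      (if s.2 then 1 else -1) * (2 * Z ^ 2) * squareArg Z a b s ^ 2 := by
    simp only [Fintype.sum_prod_type, Fintype.sum_bool, squareArg, if_true, Bool.false_eq_true,
      if_false]
    field_simp
    ring
  have h : mulApprox Z m a b - a * b = ∑ s : Bool × Bool, (if s.2 then 1 else -1) *
      (2 * Z ^ 2 * (sqApprox m (squareArg Z a b s) - squareArg Z a b s ^ 2)) := by
    rw [key, mulApprox, ← Finset.sum_sub_distrib]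
    exact Finset.sum_congr rfl fun s _ => by ring
  have hmem : ∀ s, 2 * Z ^ 2 * (sqApprox m (squareArg Z a b s) - squareArg Z a b s ^ 2) ∈
      Set.Icc (0 : ℝ) (Z ^ 2 / 4 ^ m / 2) := fun s => by
    obtain ⟨h₁, h₂⟩ := sqApprox_sub_sq_mem m (squareArg_mem hZ ha hb s)
    refine ⟨by positivity, ?_⟩
    calc _ ≤ 2 * Z ^ 2 * (1 / 4 / 4 ^ m) := by gcongr
      _ = _ := by ring
  rw [h]
  simp only [Fintype.sum_prod_type, Fintype.sum_bool, if_true, Bool.false_eq_true, if_false]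
  have h₁ := hmem (true, true)
  have h₂ := hmem (true, false)
  have h₃ := hmem (false, true)
  have h₄ := hmem (false, false)
  rw [abs_le]
  constructor <;> linarith [h₁.1, h₁.2, h₂.1, h₂.2, h₃.1, h₃.2, h₄.1, h₄.2]

/-- Approximate multiplication of pairs of coordinates of `y`, followed by one more layer computing
sparse affine combinations of the products and of `y`. -/
theorem ReachedByHidden.products {ι τ : Type} [Fintype ι] [Fintype τ] [Nonempty ι]
    {y : D → ι → ℝ} {ℓ M : ℕ} (h : ReachedByHidden (signParts y) ℓ M) (a b : τ → ι) {Z : ℝ}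
    (hZ : 0 < Z) (ha : ∀ x t, |y x (a t)| ≤ Z) (hb : ∀ x t, |y x (b t)| ≤ Z) (m : ℕ) :
    ∃ (κ : Type) (_ : Fintype κ) (S : D → κ → ℝ),
      ReachedByHidden S (ℓ + (m + 1))
        (M + 6 * (m + 1) * (12 * Fintype.card τ + 2 * Fintype.card ι)) ∧
      (∀ t, SparseAffine S 4 fun x => mulApprox Z m (y x (a t)) (y x (b t))) ∧
      ∀ i, SparseAffine S 2 fun x => y x i := by
  let u : D → τ × Bool × Bool → ℝ := fun x t => squareArg Z (y x (a t.1)) (y x (b t.1)) t.2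
  -- One constant and two coefficients for each of the two signed values.
  have hs : ∀ t, SparseAffine (signParts y) 5 fun x => u x t := fun t =>
    (SparseAffine.const _ _).add <| ((sparseAffine_signParts y (a t.1)).add
      ((sparseAffine_signParts y (b t.1)).const_mul _)).const_mul _
  refine ⟨_, inferInstance, ReLUNetwork.sqState u (signParts y) m, ?_, fun t => ?_, fun i => ?_⟩
  · have := h.sqState (signParts_nonneg y) (u := u)
      (fun x t => squareArg_mem hZ (ha x t.1) (hb x t.1) t.2) (by norm_num) hs m
    simp only [Fintype.card_prod, Fintype.card_bool] at this
    convert this using 3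
    ring
  · exact SparseAffine.sum (Finset.univ : Finset (Bool × Bool)) (c := 1) fun s _ =>
      (SparseAffine.coord (ReLUNetwork.sqState u (signParts y) m) (.inl ((t, s), 2))).const_mul _
  · have := (SparseAffine.coord (ReLUNetwork.sqState u (signParts y) m) (.inr (i, true))).sub
      (SparseAffine.coord (ReLUNetwork.sqState u (signParts y) m) (.inr (i, false)))
    simpa only [ReLUNetwork.sqState, Sum.elim_inr, signParts_sub] using this

end ReLUNetwork

/-! ### Spectral norm, entries and spectrum -/

section MatrixNorm

variable {m n : Type} [Fintype m] [Fintype n] [DecidableEq n]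

theorem Matrix.abs_apply_le_l2_opNorm (A : Matrix m n ℝ) (i : m) (j : n) : |A i j| ≤ ‖A‖ := by
  have h := Matrix.l2_opNorm_mulVec A (EuclideanSpace.single j 1)
  rw [show ‖EuclideanSpace.single j (1 : ℝ)‖ = 1 by simp, mul_one] at h
  refine le_trans ?_ ((PiLp.norm_apply_le _ i).trans h)
  simp

/-- The dimension factors are crude but harmless: the product errors decay geometrically in the
depth, so these factors cost only logarithms of the dimensions. -/
theorem Matrix.l2_opNorm_le_of_abs_apply_le (A : Matrix m n ℝ) {δ : ℝ} (hδ : 0 ≤ δ)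
    (h : ∀ i j, |A i j| ≤ δ) : ‖A‖ ≤ Fintype.card m * Fintype.card n * δ := by
  rw [Matrix.l2_opNorm_def]
  refine ContinuousLinearMap.opNorm_le_bound _ (by positivity) fun v => ?_
  have hv : ∀ i, |(A *ᵥ v) i| ≤ Fintype.card n * δ * ‖v‖ := fun i => by
    calc |(A *ᵥ v) i| ≤ ∑ j, |A i j * v j| := Finset.abs_sum_le_sum_abs _ _
      _ ≤ ∑ _j : n, δ * ‖v‖ := Finset.sum_le_sum fun j _ => by
        rw [abs_mul]
        exact mul_le_mul (h i j) (PiLp.norm_apply_le v j) (abs_nonneg _) hδ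
      _ = _ := by simp; ring
  have hs : ∀ w : EuclideanSpace ℝ m, ‖w‖ ≤ ∑ i, |w i| := fun w => by
    rw [EuclideanSpace.norm_eq]
    refine Real.sqrt_le_iff.2 ⟨Finset.sum_nonneg fun _ _ => abs_nonneg _, ?_⟩
    exact Finset.sum_sq_le_sq_sum_of_nonneg fun _ _ => abs_nonneg _
  calc _ ≤ ∑ i, |(A *ᵥ v) i| := hs _
    _ ≤ ∑ _i : m, Fintype.card n * δ * ‖v‖ := Finset.sum_le_sum fun i _ => hv i
    _ = _ := by simp; ring

theorem Matrix.l2_opNorm_transpose [DecidableEq m] (A : Matrix m n ℝ) : ‖Aᵀ‖ = ‖A‖ := by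
  rw [← Matrix.conjTranspose_eq_transpose_of_trivial, Matrix.l2_opNorm_conjTranspose]

theorem Matrix.l2_opNorm_one_le : ‖(1 : Matrix n n ℝ)‖ ≤ 1 := by
  rw [← Matrix.diagonal_one, Matrix.l2_opNorm_diagonal]
  exact (pi_norm_le_iff_of_nonneg zero_le_one).2 fun _ => by simp

/-- Orthogonal diagonalization reduces the norm to a maximum over the eigenvalues. -/
theorem Matrix.IsHermitian.norm_sub_smul_le {A : Matrix n n ℝ} (hA : A.IsHermitian) {a c b : ℝ}
    (hb : 0 ≤ b) (h : ∀ t ∈ spectrum ℝ A, |a - c * t| ≤ b) : ‖a • 1 - c • A‖ ≤ b := by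
  have hU := hA.spectral_theorem
  rw [Unitary.conjStarAlgAut_apply] at hU
  set U := hA.eigenvectorUnitary
  have : a • 1 - c • A = (U : Matrix n n ℝ) *
      Matrix.diagonal (fun i => a - c * hA.eigenvalues i) * (star U : Matrix n n ℝ) := by
    have h₁ : (Matrix.diagonal fun i => a - c * hA.eigenvalues i : Matrix n n ℝ) =
        a • 1 - c • Matrix.diagonal (RCLike.ofReal ∘ hA.eigenvalues) := by
      ext i j
      by_cases hij : i = j
      · subst hij; simp
      · simp [hij]
    rw [h₁, mul_sub, sub_mul]
    simp only [mul_smul_comm, smul_mul_assoc, mul_one]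
    rw [← hU]
    simp
  rw [this, ← Unitary.coe_star, CStarRing.norm_mul_coe_unitary, CStarRing.norm_coe_unitary_mul,
    Matrix.l2_opNorm_diagonal]
  exact (pi_norm_le_iff_of_nonneg hb).2 fun i => h _ (hA.eigenvalues_mem_spectrum_real i)

end MatrixNorm

/-! ### Gram matrices with spectrum in [β², α²] -/

section Gram

variable {N n : ℕ} {B : Matrix (Fin N) (Fin n) ℝ} {α β : ℝ}

theorem isUnit_gram (hβ : 0 < β) (h : spectrum ℝ (Bᵀ * B) ⊆ Set.Icc (β ^ 2) (α ^ 2)) :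
    IsUnit (Bᵀ * B) := by
  by_contra hu
  have := (h (spectrum.zero_mem ℝ hu)).1
  have : 0 < β ^ 2 := by positivity
  linarith

/-- Lets the dimension factor n²N in the error of the Gram product be replaced by N³, which is what
`exists_depth` handles. -/
theorem le_of_isUnit_gram (h : IsUnit (Bᵀ * B)) : n ≤ N := by
  have h₁ := Matrix.rank_of_isUnit _ h
  have h₂ := Matrix.rank_mul_le_left Bᵀ B
  have h₃ := Matrix.rank_le_width Bᵀ
  rw [Fintype.card_fin] at h₁
  omega

theorem norm_gram_le (h : spectrum ℝ (Bᵀ * B) ⊆ Set.Icc (β ^ 2) (α ^ 2)) : ‖Bᵀ * B‖ ≤ α ^ 2 := by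
  have hH : (Bᵀ * B).IsHermitian := by
    simpa using Matrix.isHermitian_conjTranspose_mul_self B
  simpa using hH.norm_sub_smul_le (a := 0) (c := 1) (sq_nonneg α) fun t ht => by
    obtain ⟨h₁, h₂⟩ := h ht
    rw [zero_sub, one_mul, abs_neg, abs_of_nonneg ((sq_nonneg β).trans h₁)]
    exact h₂

theorem norm_one_sub_smul_gram_le (hβ : 0 < β)
    (h : spectrum ℝ (Bᵀ * B) ⊆ Set.Icc (β ^ 2) (α ^ 2)) :
    ‖1 - (1 / (α ^ 2 + β ^ 2)) • (Bᵀ * B)‖ ≤ 1 - β ^ 2 / (α ^ 2 + β ^ 2) := by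
  have hH : (Bᵀ * B).IsHermitian := by
    simpa using Matrix.isHermitian_conjTranspose_mul_self B
  have hs : 0 < α ^ 2 + β ^ 2 := by positivity
  have e : 1 - β ^ 2 / (α ^ 2 + β ^ 2) = α ^ 2 / (α ^ 2 + β ^ 2) := by
    field_simp
    ring
  rw [e, ← one_smul ℝ (1 : Matrix (Fin n) (Fin n) ℝ)]
  refine hH.norm_sub_smul_le (by positivity) fun t ht => ?_
  obtain ⟨h₁, h₂⟩ := h ht
  have : 1 - 1 / (α ^ 2 + β ^ 2) * t = (α ^ 2 + β ^ 2 - t) / (α ^ 2 + β ^ 2) := by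
    field_simp
  rw [this, abs_div, abs_of_pos hs]
  gcongr
  rw [abs_le]
  constructor <;> linarith [sq_nonneg β]

/-- From A⁻¹ = s + (1 − sA)A⁻¹, where 1 − sA has norm at most 1 − sβ², the last term can be absorbed
into the left side. -/
theorem norm_inv_gram_le (hβ : 0 < β) (h : spectrum ℝ (Bᵀ * B) ⊆ Set.Icc (β ^ 2) (α ^ 2)) :
    ‖(Bᵀ * B)⁻¹‖ ≤ 1 / β ^ 2 := by
  have h₁ := norm_one_sub_smul_gram_le hβ h
  have hu := (Matrix.isUnit_iff_isUnit_det _).1 (isUnit_gram hβ h)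
  set A := Bᵀ * B
  set s := 1 / (α ^ 2 + β ^ 2) with hs
  have hs₀ : 0 < s := by positivity
  have e : A⁻¹ = s • 1 + (1 - s • A) * A⁻¹ := by
    rw [sub_mul, smul_mul_assoc, Matrix.mul_nonsing_inv _ hu, one_mul]
    abel
  have h₂ : ‖A⁻¹‖ ≤ s + (1 - s * β ^ 2) * ‖A⁻¹‖ := by
    calc ‖A⁻¹‖ = ‖s • (1 : Matrix (Fin n) (Fin n) ℝ) + (1 - s • A) * A⁻¹‖ := by rw [← e]
      _ ≤ ‖s • (1 : Matrix (Fin n) (Fin n) ℝ)‖ + ‖1 - s • A‖ * ‖A⁻¹‖ :=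
        (norm_add_le _ _).trans (add_le_add_right (norm_mul_le _ _) _)
      _ ≤ s * 1 + (1 - s * β ^ 2) * ‖A⁻¹‖ := by
        rw [norm_smul, Real.norm_of_nonneg hs₀.le]
        gcongr
        · exact Matrix.l2_opNorm_one_le
        · rw [hs, one_div_mul_eq_div]
          exact h₁
      _ = _ := by rw [mul_one]
  rw [le_div_iff₀ (by positivity)]
  have : s * (‖A⁻¹‖ * β ^ 2) ≤ s * 1 := by linarith
  exact le_of_mul_le_mul_left this hs₀

theorem norm_le_of_gram (hα : 0 ≤ α) (h : spectrum ℝ (Bᵀ * B) ⊆ Set.Icc (β ^ 2) (α ^ 2)) :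
    ‖B‖ ≤ α := by
  have h₁ := norm_gram_le h
  rw [← Matrix.conjTranspose_eq_transpose_of_trivial, Matrix.l2_opNorm_conjTranspose_mul_self] at h₁
  nlinarith [norm_nonneg B]

theorem norm_gram_sub_gram_le (B B' : Matrix (Fin N) (Fin n) ℝ) :
    ‖Bᵀ * B - B'ᵀ * B'‖ ≤ (‖B‖ + ‖B'‖) * ‖B - B'‖ := by
  have : Bᵀ * B - B'ᵀ * B' = Bᵀ * (B - B') + (B - B')ᵀ * B' := by
    rw [Matrix.transpose_sub, Matrix.mul_sub, Matrix.sub_mul]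
    abel
  rw [this]
  refine (norm_add_le _ _).trans ?_
  have h₁ := Matrix.l2_opNorm_mul Bᵀ (B - B')
  have h₂ := Matrix.l2_opNorm_mul (B - B')ᵀ B'
  rw [Matrix.l2_opNorm_transpose] at h₁ h₂
  linarith

end Gram

/-! ### One perturbed Newton step -/

section Newton

variable {n : ℕ}

local notation "𝕄" => Matrix (Fin n) (Fin n) ℝ

theorem newton_residual_le {A X E₁ E₂ : 𝕄} {a ρ e : ℝ} (hA : ‖A‖ ≤ a)
    (hρ : ‖1 - A * X‖ ≤ ρ) (hρ₁ : ρ ≤ 1) (h₁ : ‖E₁‖ ≤ e) (h₂ : ‖E₂‖ ≤ e) :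
    ‖1 - A * (X * (2 - (A * X + E₁)) + E₂)‖ ≤ ρ ^ 2 + (2 + a) * e := by
  have key : 1 - A * (X * (2 - (A * X + E₁)) + E₂) =
      (1 - A * X) * (1 - A * X) + A * X * E₁ - A * E₂ := by noncomm_ring
  have hAX : ‖A * X‖ ≤ 2 := by
    calc ‖A * X‖ = ‖1 - (1 - A * X)‖ := by rw [sub_sub_cancel]
      _ ≤ ‖(1 : 𝕄)‖ + ‖1 - A * X‖ := norm_sub_le _ _
      _ ≤ 2 := by linarith [Matrix.l2_opNorm_one_le (n := Fin n)]
  have he : 0 ≤ e := (norm_nonneg _).trans h₁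
  have hρ₀ : 0 ≤ ρ := (norm_nonneg _).trans hρ
  have ha : 0 ≤ a := (norm_nonneg _).trans hA
  calc _ ≤ ‖1 - A * X‖ * ‖1 - A * X‖ + ‖A * X‖ * ‖E₁‖ + ‖A‖ * ‖E₂‖ := by
        rw [key]
        refine (norm_sub_le _ _).trans (add_le_add ((norm_add_le _ _).trans ?_) (norm_mul_le _ _))
        exact add_le_add (norm_mul_le _ _) (norm_mul_le _ _)
    _ ≤ ρ * ρ + 2 * e + a * e := by gcongr
    _ = _ := by ring

theorem norm_newton_factor_le {A X E : 𝕄} {ρ e : ℝ} (hρ : ‖1 - A * X‖ ≤ ρ) (hρ₁ : ρ ≤ 1)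
    (h : ‖E‖ ≤ e) (he : e ≤ 1) : ‖2 - (A * X + E)‖ ≤ 3 := by
  have key : 2 - (A * X + E) = 1 + (1 - A * X) - E := by
    rw [← one_add_one_eq_two]
    abel
  rw [key]
  refine (norm_sub_le _ _).trans ?_
  have := norm_add_le (1 : 𝕄) (1 - A * X)
  linarith [Matrix.l2_opNorm_one_le (n := Fin n)]

/-- A priori bound keeping all iterates within the range of the approximate multiplication. The
contribution of A − A' is at most ‖X‖/4 and is absorbed. -/
theorem norm_le_of_residual {A A' X : 𝕄} {β : ℝ} (hβ : 0 < β) (hu : IsUnit A)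
    (hA : ‖A⁻¹‖ ≤ 1 / β ^ 2) (hA' : ‖A - A'‖ ≤ β ^ 2 / 4) (hr : ‖1 - A' * X‖ ≤ 1) :
    ‖X‖ ≤ 3 / β ^ 2 := by
  have e : X = A⁻¹ * (1 - (1 - A' * X) + (A - A') * X) := by
    have : 1 - (1 - A' * X) + (A - A') * X = A * X := by noncomm_ring
    rw [this, ← Matrix.mul_assoc, Matrix.nonsing_inv_mul _ ((Matrix.isUnit_iff_isUnit_det _).1 hu),
      Matrix.one_mul]
  have h₁ : ‖1 - (1 - A' * X) + (A - A') * X‖ ≤ 2 + β ^ 2 / 4 * ‖X‖ := by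
    refine (norm_add_le _ _).trans (add_le_add ?_ ?_)
    · refine (norm_sub_le _ _).trans ?_
      linarith [Matrix.l2_opNorm_one_le (n := Fin n)]
    · exact (norm_mul_le _ _).trans (by gcongr)
  have h₂ : ‖X‖ ≤ 1 / β ^ 2 * (2 + β ^ 2 / 4 * ‖X‖) := by
    conv_lhs => rw [e]
    exact (norm_mul_le _ _).trans (mul_le_mul hA h₁ (norm_nonneg _) (by positivity))
  have h₃ : 1 / β ^ 2 * (2 + β ^ 2 / 4 * ‖X‖) = 2 / β ^ 2 + ‖X‖ / 4 := by
    field_simp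
  have h₄ : 3 / β ^ 2 = 3 / 2 * (2 / β ^ 2) := by ring
  rw [h₄]
  have : 0 < 2 / β ^ 2 := by positivity
  linarith

/-- A⁻¹ − X = A⁻¹(1 − AX), and replacing A by A' costs (A − A')X. The residual contributes ε/2 and
the replacement 3ε/8. -/
theorem norm_inv_sub_le {A A' X : 𝕄} {β ε : ℝ} (hβ : 0 < β) (hε : 0 < ε) (hu : IsUnit A)
    (hA : ‖A⁻¹‖ ≤ 1 / β ^ 2) (hA' : ‖A - A'‖ ≤ ε * β ^ 4 / 8) (hX : ‖X‖ ≤ 3 / β ^ 2)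
    (hr : ‖1 - A' * X‖ ≤ β ^ 2 / 2 * ε) : ‖A⁻¹ - X‖ ≤ ε := by
  have e : A⁻¹ - X = A⁻¹ * (1 - A' * X - (A - A') * X) := by
    have : 1 - A' * X - (A - A') * X = 1 - A * X := by noncomm_ring
    rw [this, Matrix.mul_sub, ← Matrix.mul_assoc,
      Matrix.nonsing_inv_mul _ ((Matrix.isUnit_iff_isUnit_det _).1 hu), Matrix.one_mul,
      Matrix.mul_one]
  rw [e]
  calc _ ≤ ‖A⁻¹‖ * (‖1 - A' * X‖ + ‖A - A'‖ * ‖X‖) := by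
        refine (norm_mul_le _ _).trans ?_
        gcongr
        exact (norm_sub_le _ _).trans (add_le_add_right (norm_mul_le _ _) _)
    _ ≤ 1 / β ^ 2 * (β ^ 2 / 2 * ε + ε * β ^ 4 / 8 * (3 / β ^ 2)) := by gcongr
    _ = 7 / 8 * ε := by
      field_simp
      ring
    _ ≤ ε := by linarith

end Newton

/-! ### The residual recursion r ↦ r² + η -/

section Recursion

/-- The bounds for the residuals of a Newton iteration with errors of size `η`. -/
noncomputable def residualBound (q η : ℝ) : ℕ → ℝ
  | 0 => q
  | k + 1 => residualBound q η k ^ 2 + η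

variable {q η : ℝ}

theorem residualBound_nonneg (hq : 0 ≤ q) (hη : 0 ≤ η) (k : ℕ) : 0 ≤ residualBound q η k := by
  cases k with
  | zero => exact hq
  | succ k => rw [residualBound]; positivity

theorem residualBound_le (hq : 0 ≤ q) (hη : 0 ≤ η) (h : η ≤ q * (1 - q)) (k : ℕ) :
    residualBound q η k ≤ q := by
  induction k with
  | zero => exact le_rfl
  | succ k ih =>
    rw [residualBound]
    nlinarith [residualBound_nonneg hq hη k]

/-- Linear phase: since r ≤ q, each step gives r² + η ≤ qr + η, and the errors sum as a geometric
series. -/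
theorem residualBound_le_pow_add (hq : 0 ≤ q) (hq₁ : q < 1) (hη : 0 ≤ η) (h : η ≤ q * (1 - q))
    (k : ℕ) : residualBound q η k ≤ q ^ (k + 1) + η / (1 - q) := by
  have hq' : 0 < 1 - q := by linarith
  induction k with
  | zero =>
    rw [residualBound, zero_add, pow_one]
    have : 0 ≤ η / (1 - q) := by positivity
    linarith
  | succ k ih =>
    rw [residualBound]
    calc _ ≤ q * (q ^ (k + 1) + η / (1 - q)) + η := by
          rw [sq]
          gcongr
          · exact residualBound_nonneg hq hη k
          · exact residualBound_le hq hη h k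
      _ = _ := by
        field_simp
        ring

theorem residualBound_add_le (hq : 0 ≤ q) (hη : 0 ≤ η) (h : η ≤ 1 / 18) {k : ℕ}
    (hk : residualBound q η k ≤ 1 / 4) (j : ℕ) :
    residualBound q η (k + j) ≤ (1 / 4) ^ 2 ^ j + 3 * η := by
  induction j with
  | zero =>
    rw [add_zero, pow_zero, pow_one]
    linarith
  | succ j ih =>
    rw [← add_assoc, residualBound, pow_succ 2 j, pow_mul]
    have h₁ : ((1 : ℝ) / 4) ^ 2 ^ j ≤ 1 / 4 := by
      simpa using pow_le_pow_of_le_one (by norm_num : (0 : ℝ) ≤ 1 / 4) (by norm_num)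
        (Nat.one_le_two_pow : 1 ≤ 2 ^ j)
    have h₀ : (0 : ℝ) ≤ (1 / 4) ^ 2 ^ j := by positivity
    set t : ℝ := (1 / 4) ^ 2 ^ j
    have h₂ := pow_le_pow_left₀ (residualBound_nonneg hq hη (k + j)) ih 2
    -- In (t + 3η)² + η, the bound t ≤ 1/4 gives 6tη ≤ 3η/2 and η ≤ 1/18 gives 9η² ≤ η/2, so the
    -- excess over t² is at most 3η.
    nlinarith

end Recursion

/-! ### Number of Newton steps and depth of the multiplications -/

theorem two_le_logb_one_div {ε : ℝ} (hε : ε ∈ Set.Ioo (0 : ℝ) (1 / 4)) :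
    2 ≤ Real.logb 2 (1 / ε) := by
  rw [Real.le_logb_iff_rpow_le (by norm_num) (by have := hε.1; positivity),
    le_div_iff₀ hε.1]
  norm_num
  linarith [hε.2]

theorem one_le_logb_logb {ε : ℝ} (hε : ε ∈ Set.Ioo (0 : ℝ) (1 / 4)) :
    1 ≤ Real.logb 2 (Real.logb 2 (1 / ε)) := by
  have := two_le_logb_one_div hε
  rw [Real.le_logb_iff_rpow_le (by norm_num) (by linarith)]
  simpa using this

theorem one_half_pow_le {ε x : ℝ} (hε : 0 < ε) (hx : 0 < x) {k : ℕ}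
    (hk : Real.logb 2 (1 / ε) + Real.logb 2 x ≤ k) : (1 / 2 : ℝ) ^ k ≤ ε / x := by
  rw [← Real.logb_mul (by positivity) hx.ne', Real.logb_le_iff_le_rpow (by norm_num)
    (by positivity), Real.rpow_natCast] at hk
  rw [one_div, inv_pow, inv_le_comm₀ (by positivity) (by positivity)]
  refine le_trans (le_of_eq ?_) hk
  field_simp

theorem exists_newton_steps {q b : ℝ} (hq : 0 < q) (hq₁ : q < 1) (hb : 0 < b) :
    ∃ c C : ℝ, 0 < c ∧ 0 < C ∧ ∀ ε ∈ Set.Ioo (0 : ℝ) (1 / 4),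
      (∀ k, residualBound q (c * ε) k ≤ 1) ∧
      ∃ K : ℕ, (K : ℝ) ≤ C * Real.logb 2 (Real.logb 2 (1 / ε)) ∧
        residualBound q (c * ε) K ≤ b * ε := by
  have hq' : 0 < 1 - q := by linarith
  obtain ⟨k₀, hk₀⟩ := exists_pow_lt_of_lt_one (by norm_num : (0 : ℝ) < 1 / 8) hq₁
  obtain ⟨j₀, hj₀⟩ := exists_pow_lt_of_lt_one (half_pos hb) (by norm_num : (1 / 4 : ℝ) < 1)
  -- In order: residuals stay below q; the linear phase leaves an error of at most 1/8; the
  -- quadratic phase applies; its error 3cε is at most bε/2.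
  set c := min (min (q * (1 - q)) ((1 - q) / 8)) (min (1 / 18) (b / 6)) with hc
  have hc₀ : 0 < c := by positivity
  have hc₁ : c ≤ q * (1 - q) := (min_le_left _ _).trans (min_le_left _ _)
  have hc₂ : c ≤ (1 - q) / 8 := (min_le_left _ _).trans (min_le_right _ _)
  have hc₃ : c ≤ 1 / 18 := (min_le_right _ _).trans (min_le_left _ _)
  have hc₄ : c ≤ b / 6 := (min_le_right _ _).trans (min_le_right _ _)
  refine ⟨c, k₀ + j₀ + 2, hc₀, by positivity, fun ε hε => ?_⟩
  obtain ⟨hε₀, hε₁⟩ := hε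
  have hη₀ : 0 ≤ c * ε := by positivity
  have hη : c * ε ≤ c := by nlinarith
  have hle := residualBound_le hq.le hη₀ (hη.trans hc₁)
  have hl := two_le_logb_one_div ⟨hε₀, hε₁⟩
  have hll := one_le_logb_logb ⟨hε₀, hε₁⟩
  set l := Real.logb 2 (1 / ε) with hldef
  -- The k₀ steps reach 1/4, the ceiling brings the quadratic phase to ε, and j₀ further steps
  -- supply the factor b/2. Constants are absorbed since log₂ log₂(1/ε) ≥ 1.
  refine ⟨fun k => (hle k).trans hq₁.le, k₀ + (⌈Real.logb 2 l⌉₊ + j₀), ?_, ?_⟩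
  · have := (Nat.ceil_lt_add_one (by linarith : 0 ≤ Real.logb 2 l)).le
    push_cast
    nlinarith [(Nat.cast_nonneg k₀ : (0 : ℝ) ≤ k₀), (Nat.cast_nonneg j₀ : (0 : ℝ) ≤ j₀)]
  · have h₁ : residualBound q (c * ε) k₀ ≤ 1 / 4 := by
      refine (residualBound_le_pow_add hq.le hq₁ hη₀ (hη.trans hc₁) k₀).trans ?_
      have : c * ε / (1 - q) ≤ 1 / 8 := by
        rw [div_le_iff₀ hq']
        linarith
      have : q ^ (k₀ + 1) ≤ q ^ k₀ := pow_le_pow_of_le_one hq.le hq₁.le (Nat.le_succ _)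
      linarith
    refine (residualBound_add_le hq.le hη₀ (hη.trans hc₃) h₁ _).trans ?_
    set J := ⌈Real.logb 2 l⌉₊ with hJ
    have h₂ : l ≤ (2 : ℝ) ^ J := by
      have := Nat.le_ceil (Real.logb 2 l)
      rwa [Real.logb_le_iff_le_rpow (by norm_num) (by linarith), Real.rpow_natCast] at this
    have h₃ : l ≤ ((2 ^ J : ℕ) : ℝ) := by exact_mod_cast h₂
    have h₄ : (1 / 2 : ℝ) ^ 2 ^ J ≤ ε := by
      have := one_half_pow_le hε₀ one_pos (k := 2 ^ J) (by rwa [Real.logb_one, add_zero])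
      rwa [div_one] at this
    have h₅ : 2 ^ J + j₀ ≤ 2 ^ (J + j₀) := by
      have : j₀ + 1 ≤ 2 ^ j₀ := Nat.lt_two_pow_self
      have : 1 ≤ 2 ^ J := Nat.one_le_two_pow
      rw [pow_add]
      nlinarith
    have h₆ : (1 / 4 : ℝ) ^ 2 ^ (J + j₀) ≤ ε * (b / 2) := by
      calc _ ≤ (1 / 4 : ℝ) ^ (2 ^ J + j₀) :=
            pow_le_pow_of_le_one (by norm_num) (by norm_num) h₅
        _ = (1 / 4 : ℝ) ^ 2 ^ J * (1 / 4) ^ j₀ := pow_add _ _ _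
        _ ≤ ε * (b / 2) := by
          gcongr
          exact (pow_le_pow_left₀ (by norm_num) (by norm_num) _).trans h₄
    nlinarith

theorem exists_depth {c : ℝ} (hc : 0 < c) :
    ∃ C : ℝ, 0 < C ∧ ∀ ε ∈ Set.Ioo (0 : ℝ) (1 / 4), ∀ n : ℕ, 0 < n → ∃ m : ℕ,
      (m : ℝ) + 2 ≤ C * (Real.logb 2 (1 / ε) + Real.logb 2 n) ∧
      (n : ℝ) ^ 3 * (1 / 4 ^ m) ≤ c * ε := by
  obtain ⟨m₀, hm₀⟩ := exists_pow_lt_of_lt_one hc (by norm_num : (1 / 4 : ℝ) < 1)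
  refine ⟨m₀ + 6, by positivity, fun ε hε n hn => ?_⟩
  have hl := two_le_logb_one_div hε
  obtain ⟨hε₀, hε₁⟩ := hε
  have hn₁ : (1 : ℝ) ≤ n := by exact_mod_cast hn
  have hn₀ : 0 ≤ Real.logb 2 n := Real.logb_nonneg (by norm_num) hn₁
  set l := Real.logb 2 (1 / ε)
  set t := ⌈l + Real.logb 2 n⌉₊
  -- 4⁻²ᵗ is at most (ε/n)⁴, which beats n³; m₀ supplies the factor c.
  refine ⟨2 * t + m₀, ?_, ?_⟩
  · have := (Nat.ceil_lt_add_one (by linarith : 0 ≤ l + Real.logb 2 n)).le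
    push_cast
    nlinarith [(Nat.cast_nonneg m₀ : (0 : ℝ) ≤ m₀)]
  · have h := one_half_pow_le hε₀ (by linarith : (0 : ℝ) < n)
      (Nat.le_ceil (l + Real.logb 2 n))
    have e : (1 : ℝ) / 4 ^ (2 * t + m₀) = ((1 / 2) ^ t) ^ 4 * (1 / 4) ^ m₀ := by
      rw [← one_div_pow, pow_add, ← pow_mul, mul_comm t 4, pow_mul, pow_mul]
      norm_num
    rw [e]
    calc _ ≤ (n : ℝ) ^ 3 * ((ε / n) ^ 4 * c) := by gcongr
      _ = c * ε * (ε ^ 3 / n) := by field_simp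
      _ ≤ c * ε * 1 := by
        gcongr
        rw [div_le_one (by positivity)]
        exact (pow_le_one₀ hε₀.le (by linarith)).trans hn₁
      _ = c * ε := mul_one _

/-! ### Matrix products and Newton steps as networks -/

namespace ReLUNetwork

/-- The matrix product with all products of entries replaced by their approximations. -/
noncomputable def matMulApprox {n N k : ℕ} (Z : ℝ) (m : ℕ) (A : Matrix (Fin n) (Fin N) ℝ)
    (B : Matrix (Fin N) (Fin k) ℝ) : Matrix (Fin n) (Fin k) ℝ :=
  Matrix.of fun i j => ∑ l, mulApprox Z m (A i l) (B l j)

theorem norm_matMulApprox_sub_le {n N k : ℕ} {Z : ℝ} (hZ : 0 < Z) (m : ℕ)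
    {A : Matrix (Fin n) (Fin N) ℝ} {B : Matrix (Fin N) (Fin k) ℝ} (hA : ‖A‖ ≤ Z) (hB : ‖B‖ ≤ Z) :
    ‖matMulApprox Z m A B - A * B‖ ≤ n * k * (N * (Z ^ 2 / 4 ^ m)) := by
  have := Matrix.l2_opNorm_le_of_abs_apply_le (matMulApprox Z m A B - A * B)
    (δ := N * (Z ^ 2 / 4 ^ m)) (by positivity) fun i j => ?_
  · simpa using this
  · rw [Matrix.sub_apply, matMulApprox, Matrix.of_apply, Matrix.mul_apply,
      ← Finset.sum_sub_distrib]
    calc _ ≤ ∑ l, |mulApprox Z m (A i l) (B l j) - A i l * B l j| :=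
          Finset.abs_sum_le_sum_abs _ _
      _ ≤ ∑ _l : Fin N, Z ^ 2 / 4 ^ m := Finset.sum_le_sum fun l _ =>
          abs_mulApprox_sub_le hZ ((A.abs_apply_le_l2_opNorm i l).trans hA)
            ((B.abs_apply_le_l2_opNorm l j).trans hB) m
      _ = _ := by simp

/-- The approximation of the factor `2 - A X` of a Newton step. -/
noncomputable def newtonFactor {n : ℕ} (Z : ℝ) (m : ℕ) (A X : Matrix (Fin n) (Fin n) ℝ) :
    Matrix (Fin n) (Fin n) ℝ :=
  2 - matMulApprox Z m A X

/-- The approximation of the Newton step `X ↦ X (2 - A X)` for the inverse of `A`. -/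
noncomputable def newtonStep {n : ℕ} (Z : ℝ) (m : ℕ) (A X : Matrix (Fin n) (Fin n) ℝ) :
    Matrix (Fin n) (Fin n) ℝ :=
  matMulApprox Z m X (newtonFactor Z m A X)

/-- The entries of two matrices as one vector. -/
def matPair {n : ℕ} {Ω : Type} (A X : Ω → Matrix (Fin n) (Fin n) ℝ) (x : Ω) :
    (Fin n × Fin n) ⊕ (Fin n × Fin n) → ℝ :=
  Sum.elim (fun i => A x i.1 i.2) (fun i => X x i.1 i.2)

variable {p n : ℕ} {D : Set (Fin p → ℝ)}

/-- Two multiplication blocks of m + 1 layers, each followed by a layer that sums the products and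
splits signs. X is kept through the first block, and A through both for later steps. -/
theorem ReachedByHidden.newtonStep (hn : 0 < n) {A X : D → Matrix (Fin n) (Fin n) ℝ} {ℓ M : ℕ}
    (h : ReachedByHidden (signParts (matPair A X)) ℓ M) {Z : ℝ} (hZ : 0 < Z) (m : ℕ)
    (hA : ∀ x, ‖A x‖ ≤ Z) (hX : ∀ x, ‖X x‖ ≤ Z) (hC : ∀ x, ‖newtonFactor Z m (A x) (X x)‖ ≤ Z) :
    ReachedByHidden (signParts (matPair A fun x => ReLUNetwork.newtonStep Z m (A x) (X x)))
      (ℓ + 2 * (m + 2)) (M + 300 * (m + 1) * n ^ 3) := by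
  have : Nonempty (Fin n × Fin n) := ⟨(⟨0, hn⟩, ⟨0, hn⟩)⟩
  obtain ⟨κ₁, _, S₁, hS₁, hmul₁, hy₁⟩ := h.products (τ := Fin n × Fin n × Fin n)
    (fun t => .inl (t.1, t.2.1)) (fun t => .inr (t.2.1, t.2.2)) hZ
    (fun x t => ((A x).abs_apply_le_l2_opNorm _ _).trans (hA x))
    (fun x t => ((X x).abs_apply_le_l2_opNorm _ _).trans (hX x)) m
  let y₁ : D → (Fin n × Fin n) ⊕ (Fin n × Fin n) ⊕ (Fin n × Fin n) → ℝ := fun x =>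
    Sum.elim (fun i => A x i.1 i.2) (Sum.elim (fun i => X x i.1 i.2)
      fun i => newtonFactor Z m (A x) (X x) i.1 i.2)
  have h₁ : ReachedByHidden (signParts y₁) _ _ := hS₁.signLayer (c := 4 * n + 1) (by
    rintro (i | i | ⟨i, j⟩)
    · exact (hy₁ (.inl i)).mono (by omega)
    · exact (hy₁ (.inr i)).mono (by omega)
    · refine ((SparseAffine.const S₁ ((2 : Matrix (Fin n) (Fin n) ℝ) i j)).sub
        (SparseAffine.sum (Finset.univ : Finset (Fin n)) fun l _ => hmul₁ (i, l, j))).mono ?_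
      rw [Finset.card_univ, Fintype.card_fin]
      omega)
  obtain ⟨κ₂, _, S₂, hS₂, hmul₂, hy₂⟩ := h₁.products (τ := Fin n × Fin n × Fin n)
    (fun t => .inr (.inl (t.1, t.2.1))) (fun t => .inr (.inr (t.2.1, t.2.2))) hZ
    (fun x t => ((X x).abs_apply_le_l2_opNorm _ _).trans (hX x))
    (fun x t => ((newtonFactor Z m (A x) (X x)).abs_apply_le_l2_opNorm _ _).trans (hC x)) m
  have h₂ : ReachedByHidden
      (signParts (matPair A fun x => ReLUNetwork.newtonStep Z m (A x) (X x))) _ _ :=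
    hS₂.signLayer (c := 4 * n) (by
      rintro (i | ⟨i, j⟩)
      · exact (hy₂ (.inl i)).mono (by omega)
      · refine (SparseAffine.sum (Finset.univ : Finset (Fin n))
          fun l _ => hmul₂ (i, l, j)).mono ?_
        rw [Finset.card_univ, Fintype.card_fin]
        omega)
  convert h₂.mono (M' := M + 300 * (m + 1) * n ^ 3) ?_ using 1
  · ring
  · simp only [Fintype.card_prod, Fintype.card_sum, Fintype.card_fin]
    have e₁ : n * n ≤ n ^ 3 := by nlinarith [Nat.mul_le_mul_left (n * n) hn]
    have e₂ : (m + 1) * (n * n) ≤ (m + 1) * n ^ 3 := Nat.mul_le_mul_left _ e₁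
    have e₃ : n ^ 3 ≤ (m + 1) * n ^ 3 := Nat.le_mul_of_pos_left _ (Nat.succ_pos m)
    nlinarith

theorem reachedByHidden_gram {N : ℕ} (hN : 0 < N) (hn : 0 < n) (Φ : ReLUNetwork p (n * N))
    {Z : ℝ} (hZ : 0 < Z) (m : ℕ) (hB : ∀ x : D, ‖matr (Φ.realize x)‖ ≤ Z) (s : ℝ) :
    ReachedByHidden (D := D) (signParts (matPair
        (fun x => matMulApprox Z m (matr (Φ.realize x))ᵀ (matr (Φ.realize x))) fun _ => s • 1))
      (Φ.numLayers + (m + 2)) (2 * Φ.numParams + 110 * (m + 1) * (N * n ^ 2)) := by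
  have : Nonempty (Fin n × Fin n) := ⟨(⟨0, hn⟩, ⟨0, hn⟩)⟩
  have : Nonempty (Fin (n * N)) := ⟨⟨0, Nat.mul_pos hn hN⟩⟩
  obtain ⟨κ, _, S, hS, hmul, -⟩ := (ReachedByHidden.of_network (D := D)
    (Nat.mul_pos hn hN) Φ).products (τ := Fin n × Fin N × Fin n)
    (fun t => finProdFinEquiv (t.1, t.2.1)) (fun t => finProdFinEquiv (t.2.2, t.2.1)) hZ
    (fun x t => ((matr (Φ.realize x)).abs_apply_le_l2_opNorm t.2.1 t.1).trans (hB x))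
    (fun x t => ((matr (Φ.realize x)).abs_apply_le_l2_opNorm t.2.1 t.2.2).trans (hB x)) m
  have h : ReachedByHidden (signParts (matPair
      (fun x : D => matMulApprox Z m (matr (Φ.realize x))ᵀ (matr (Φ.realize x)))
      fun _ => s • 1)) _ _ :=
    hS.signLayer (c := 4 * N) (by
      rintro (⟨i, j⟩ | ⟨i, j⟩)
      · refine (SparseAffine.sum (Finset.univ : Finset (Fin N))
          fun l _ => hmul (i, l, j)).mono ?_
        rw [Finset.card_univ, Fintype.card_fin]
        omega
      -- The initial iterate is constant and is written into the biases.
      · exact (SparseAffine.const S ((s • (1 : Matrix (Fin n) (Fin n) ℝ)) i j)).mono (by omega))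
  refine h.mono ?_
  simp only [Fintype.card_prod, Fintype.card_sum, Fintype.card_fin]
  have e₁ : n * N ≤ N * n ^ 2 := by nlinarith [Nat.mul_le_mul_left (n * N) hn]
  have e₂ : (m + 1) * (n * N) ≤ (m + 1) * (N * n ^ 2) := Nat.mul_le_mul_left _ e₁
  have e₃ : N * n ^ 2 ≤ (m + 1) * (N * n ^ 2) := Nat.le_mul_of_pos_left _ (Nat.succ_pos m)
  nlinarith

theorem ReachedByHidden.exists_network {A X : D → Matrix (Fin n) (Fin n) ℝ} {ℓ M : ℕ}
    (h : ReachedByHidden (signParts (matPair A X)) ℓ M) :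
    ∃ Φ : ReLUNetwork p (n * n), Φ.numLayers = ℓ + 1 ∧ Φ.numParams ≤ M + 2 * n ^ 2 ∧
      ∀ x : D, matr (Φ.realize x) = X x := by
  obtain ⟨Φ, h₁, h₂, h₃⟩ := h.output (c := 2)
    (g := fun x i => X x (finProdFinEquiv.symm i).2 (finProdFinEquiv.symm i).1)
    fun i => sparseAffine_signParts (matPair A X)
      (.inr ((finProdFinEquiv.symm i).2, (finProdFinEquiv.symm i).1))
  refine ⟨Φ, h₁, by rwa [sq], fun x => ?_⟩
  ext i j
  simp [matr, h₃]

/-- Iterated approximate Newton steps, with the accuracy of the approximation of the products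
controlling the residuals. -/
theorem ReachedByHidden.newton_iterate (hn : 0 < n) {A A₀ X₀ : D → Matrix (Fin n) (Fin n) ℝ}
    {ℓ M : ℕ} (h : ReachedByHidden (signParts (matPair A X₀)) ℓ M) {a β q η e Z : ℝ} {m : ℕ}
    (hβ : 0 < β) (ha : 0 ≤ a) (hZ : Z = a + 3 / β ^ 2 + 3) (hu : ∀ x, IsUnit (A₀ x))
    (hA₀ : ∀ x, ‖(A₀ x)⁻¹‖ ≤ 1 / β ^ 2) (hAA : ∀ x, ‖A₀ x - A x‖ ≤ β ^ 2 / 4)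
    (hA : ∀ x, ‖A x‖ ≤ a) (hX₀ : ∀ x, ‖1 - A x * X₀ x‖ ≤ q)
    (hρ : ∀ k, residualBound q η k ≤ 1) (he : n ^ 3 * (Z ^ 2 / 4 ^ m) ≤ e) (he₁ : e ≤ 1)
    (hη : (2 + a) * e ≤ η) (K : ℕ) :
    ∃ X : D → Matrix (Fin n) (Fin n) ℝ, (∀ x, ‖1 - A x * X x‖ ≤ residualBound q η K) ∧
      ReachedByHidden (signParts (matPair A X)) (ℓ + K * (2 * (m + 2)))
        (M + K * (300 * (m + 1) * n ^ 3)) := by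
  have hb : 0 < 3 / β ^ 2 := by positivity
  have hZ₀ : 0 < Z := by linarith
  induction K with
  | zero => exact ⟨X₀, hX₀, by simpa using h⟩
  | succ K ih =>
    obtain ⟨X, hr, hX⟩ := ih
    have hprod : ∀ B C : Matrix (Fin n) (Fin n) ℝ, ‖B‖ ≤ Z → ‖C‖ ≤ Z →
        ‖matMulApprox Z m B C - B * C‖ ≤ e := fun B C hB hC =>
      (norm_matMulApprox_sub_le hZ₀ m hB hC).trans ((le_of_eq (by ring)).trans he)
    -- The factors A, X and 2 − AX are bounded by a, 3/β² and 3 at every step, so their sum Z serves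
    -- throughout.
    have hXn : ∀ x, ‖X x‖ ≤ 3 / β ^ 2 := fun x =>
      norm_le_of_residual hβ (hu x) (hA₀ x) (hAA x) ((hr x).trans (hρ K))
    have hAZ : ∀ x, ‖A x‖ ≤ Z := fun x => (hA x).trans (by linarith)
    have hXZ : ∀ x, ‖X x‖ ≤ Z := fun x => (hXn x).trans (by linarith)
    have e₁ : ∀ x, newtonFactor Z m (A x) (X x) =
        2 - (A x * X x + (matMulApprox Z m (A x) (X x) - A x * X x)) := fun x => by
      rw [add_sub_cancel, newtonFactor]
    have hCZ : ∀ x, ‖newtonFactor Z m (A x) (X x)‖ ≤ Z := fun x => by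
      rw [e₁]
      exact (norm_newton_factor_le (hr x) (hρ K) (hprod _ _ (hAZ x) (hXZ x)) he₁).trans
        (by linarith)
    refine ⟨fun x => ReLUNetwork.newtonStep Z m (A x) (X x), fun x => ?_, ?_⟩
    · have := newton_residual_le (hA x) (hr x) (hρ K) (hprod _ _ (hAZ x) (hXZ x))
        (hprod _ _ (hXZ x) (hCZ x))
      rw [← e₁, add_sub_cancel] at this
      rw [residualBound]
      exact this.trans (by linarith)
    · convert hX.newtonStep hn hZ₀ m hAZ hXZ hCZ using 1 <;> ring

end ReLUNetwork

/-! ### Error budget for the approximate Gram matrix -/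

section Accuracy

variable {N n : ℕ} {B B' : Matrix (Fin N) (Fin n) ℝ} {α β ε : ℝ}

theorem norm_approx_le (hβ : 0 < β) (hαβ : β < α)
    (h : spectrum ℝ (Bᵀ * B) ⊆ Set.Icc (β ^ 2) (α ^ 2))
    (hB : ‖B - B'‖ ≤ innerAccuracy α β ε) : ‖B'‖ ≤ α + β / 3 := by
  have h₁ := norm_le_of_gram (hβ.le.trans hαβ.le) h
  have h₂ : innerAccuracy α β ε ≤ β / 3 := (min_le_right _ _).trans (min_le_right _ _)
  calc ‖B'‖ = ‖B - (B - B')‖ := by rw [sub_sub_cancel]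
    _ ≤ ‖B‖ + ‖B - B'‖ := norm_sub_le _ _
    _ ≤ α + β / 3 := by linarith

/-- Here ‖B‖ + ‖B'‖ ≤ α + 4α/3. The bounds stay below β²/4 and εβ⁴/8 to leave room for the error of
the Gram product. -/
theorem norm_gram_sub_le (hβ : 0 < β) (hαβ : β < α)
    (h : spectrum ℝ (Bᵀ * B) ⊆ Set.Icc (β ^ 2) (α ^ 2))
    (hB : ‖B - B'‖ ≤ innerAccuracy α β ε) :
    ‖Bᵀ * B - B'ᵀ * B'‖ ≤ β ^ 2 / 5 ∧ ‖Bᵀ * B - B'ᵀ * B'‖ ≤ ε * β ^ 4 / 10 := by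
  have hα : 0 < α := hβ.trans hαβ
  have h₁ := norm_le_of_gram hα.le h
  have h₂ := norm_approx_le hβ hαβ h hB
  have h₃ : ‖Bᵀ * B - B'ᵀ * B'‖ ≤ 7 / 3 * α * ‖B - B'‖ :=
    (norm_gram_sub_gram_le B B').trans (by gcongr; linarith)
  constructor
  · have : ‖B - B'‖ ≤ β ^ 2 / (12 * α) :=
      hB.trans ((min_le_right _ _).trans (min_le_left _ _))
    calc _ ≤ 7 / 3 * α * (β ^ 2 / (12 * α)) := h₃.trans (by gcongr)
      _ = 7 / 36 * β ^ 2 := by field_simp; norm_num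
      _ ≤ β ^ 2 / 5 := by linarith [sq_nonneg β]
  · have : ‖B - B'‖ ≤ ε * β ^ 4 / (24 * α) :=
      hB.trans ((min_le_left _ _).trans (min_le_left _ _))
    have h₄ : 0 ≤ ε * β ^ 4 := by
      by_contra! hneg
      have : ε * β ^ 4 / (24 * α) < 0 := div_neg_of_neg_of_pos hneg (by positivity)
      linarith [norm_nonneg (B - B')]
    calc _ ≤ 7 / 3 * α * (ε * β ^ 4 / (24 * α)) := h₃.trans (by gcongr)
      _ = 7 / 72 * (ε * β ^ 4) := by field_simp; ring
      _ ≤ ε * β ^ 4 / 10 := by linarith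

end Accuracy

/-! ### Assembly of the network and its size -/

theorem exists_inverse_network {α β : ℝ} (hβ : 0 < β) (hαβ : β < α) :
    ∃ C₁ C₂ C₃ : ℝ, 0 < C₁ ∧ 0 < C₂ ∧ 0 < C₃ ∧
      ∀ (p N n : ℕ) (_hN : 0 < N) (_hn : 0 < n) (D : Set (Fin p → ℝ))
        (B : (Fin p → ℝ) → Matrix (Fin N) (Fin n) ℝ) (_hB : SpectrumAssumption α β D B)
        (ε : ℝ) (_hε : ε ∈ Set.Ioo (0 : ℝ) (1 / 4)) (Ψ : ReLUNetwork p (n * N))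
        (_hΨ : ∀ μ ∈ D, ‖B μ - matr (Ψ.realize μ)‖ ≤ innerAccuracy α β ε),
        ∃ (Φ : ReLUNetwork p (n * n)) (m₁ m₂ K : ℕ),
          (m₁ : ℝ) + 2 ≤ C₁ * (Real.logb 2 (1 / ε) + Real.logb 2 N) ∧
          (m₂ : ℝ) + 2 ≤ C₂ * (Real.logb 2 (1 / ε) + Real.logb 2 n) ∧
          (K : ℝ) ≤ C₃ * Real.logb 2 (Real.logb 2 (1 / ε)) ∧
          (∀ μ ∈ D, ‖((B μ)ᵀ * B μ)⁻¹ - matr (Φ.realize μ)‖ ≤ ε) ∧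
          Φ.numLayers = Ψ.numLayers + (m₁ + 2) + K * (2 * (m₂ + 2)) + 1 ∧
          Φ.numParams ≤ 2 * Ψ.numParams + 110 * (m₁ + 1) * (N * n ^ 2) +
            K * (300 * (m₂ + 1) * n ^ 3) + 2 * n ^ 2 := by
  have hα : 0 < α := hβ.trans hαβ
  set s := 1 / (α ^ 2 + β ^ 2) with hs
  have hs₀ : 0 < s := by positivity
  have hsβ : s * β ^ 2 < 1 := by
    rw [hs, one_div_mul_eq_div, div_lt_one (by positivity)]
    linarith [sq_pos_of_pos hα]
  have hsβ₀ : 0 < s * β ^ 2 := by positivity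
  -- The exact Gram matrix gives initial residual 1 − sβ²; its approximation, off by at most β²/4,
  -- adds sβ²/4.
  obtain ⟨c, C₃, hc, hC₃, hsteps⟩ := exists_newton_steps (q := 1 - 3 / 4 * (s * β ^ 2))
    (b := β ^ 2 / 2) (by linarith) (by linarith) (by positivity)
  set a := 2 * α ^ 2 with ha
  have ha₀ : 0 ≤ a := by positivity
  set Z := a + 3 / β ^ 2 + 3 with hZ
  have hZ₀ : 0 < Z := by positivity
  -- c₁ fills the budget: 1/5 + 1/20 = 1/4 and 1/10 + 1/40 = 1/8. In c₂, the first term bounds the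
  -- error of a Newton step by cε, the second keeps product errors below 1.
  set c₁ := min (β ^ 2 / 20) (β ^ 4 / 40) with hc₁
  set c₂ := min (c / (2 + a)) 1 with hc₂
  have hc₁₀ : 0 < c₁ := by positivity
  have hc₂₀ : 0 < c₂ := by positivity
  obtain ⟨C₁, hC₁, hm₁⟩ := exists_depth (c := c₁ / (2 * α) ^ 2) (by positivity)
  obtain ⟨C₂, hC₂, hm₂⟩ := exists_depth (c := c₂ / Z ^ 2) (by positivity)
  refine ⟨C₁, C₂, C₃, hC₁, hC₂, hC₃, fun p N n hN hn D B hB ε hε Ψ hΨ => ?_⟩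
  obtain ⟨m₁, hm₁, hd₁⟩ := hm₁ ε hε N hN
  obtain ⟨m₂, hm₂, hd₂⟩ := hm₂ ε hε n hn
  obtain ⟨hρ, K, hK, hρK⟩ := hsteps ε hε
  obtain ⟨hε₀, hε₁⟩ := hε
  have hBZ : ∀ x : D, ‖matr (Ψ.realize x)‖ ≤ 2 * α := fun x =>
    (norm_approx_le hβ hαβ (hB x x.2) (hΨ x x.2)).trans (by linarith)
  have hgram := ReLUNetwork.reachedByHidden_gram (D := D) hN hn Ψ (by positivity) m₁ hBZ s
  set A : D → Matrix (Fin n) (Fin n) ℝ := fun x =>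
    ReLUNetwork.matMulApprox (2 * α) m₁ (matr (Ψ.realize x))ᵀ (matr (Ψ.realize x)) with hA
  have hu : ∀ x : D, IsUnit ((B x)ᵀ * B x) := fun x => isUnit_gram hβ (hB x x.2)
  have hinv : ∀ x : D, ‖((B x)ᵀ * B x)⁻¹‖ ≤ 1 / β ^ 2 := fun x => norm_inv_gram_le hβ (hB x x.2)
  have hAe : ∀ x : D, ‖(matr (Ψ.realize x))ᵀ * matr (Ψ.realize x) - A x‖ ≤ c₁ * ε := fun x => by
    have hnN : (n : ℝ) ≤ N := by exact_mod_cast le_of_isUnit_gram (hu x)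
    rw [norm_sub_rev]
    calc _ ≤ (n : ℝ) * n * (N * ((2 * α) ^ 2 / 4 ^ m₁)) :=
          ReLUNetwork.norm_matMulApprox_sub_le (by positivity) m₁
            (by rw [Matrix.l2_opNorm_transpose]; exact hBZ x) (hBZ x)
      _ ≤ (N : ℝ) * N * (N * ((2 * α) ^ 2 / 4 ^ m₁)) := by gcongr
      _ = (2 * α) ^ 2 * ((N : ℝ) ^ 3 * (1 / 4 ^ m₁)) := by ring
      _ ≤ (2 * α) ^ 2 * (c₁ / (2 * α) ^ 2 * ε) := by gcongr
      _ = c₁ * ε := by field_simp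
  have hdiff : ∀ x : D, ‖(B x)ᵀ * B x - A x‖ ≤ β ^ 2 / 4 ∧
      ‖(B x)ᵀ * B x - A x‖ ≤ ε * β ^ 4 / 8 := fun x => by
    obtain ⟨h₁, h₂⟩ := norm_gram_sub_le hβ hαβ (hB x x.2) (hΨ x x.2)
    have h₃ := norm_sub_le_norm_sub_add_norm_sub ((B x)ᵀ * B x)
      ((matr (Ψ.realize x))ᵀ * matr (Ψ.realize x)) (A x)
    have h₄ := hAe x
    have h₅ : c₁ * ε ≤ β ^ 2 / 20 * 1 :=
      mul_le_mul (min_le_left _ _) (by linarith) hε₀.le (by positivity)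
    have h₆ : c₁ * ε ≤ β ^ 4 / 40 * ε :=
      mul_le_mul_of_nonneg_right (min_le_right _ _) hε₀.le
    constructor <;> linarith
  have hAn : ∀ x : D, ‖A x‖ ≤ a := fun x => by
    have h₁ := norm_gram_le (hB x x.2)
    have h₂ := norm_sub_norm_le (A x) ((B x)ᵀ * B x)
    rw [norm_sub_rev] at h₂
    have h₃ : β ^ 2 ≤ α ^ 2 := by gcongr
    linarith [(hdiff x).1, sq_nonneg β]
  have hX₀ : ∀ x : D, ‖1 - A x * s • (1 : Matrix (Fin n) (Fin n) ℝ)‖ ≤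
      1 - 3 / 4 * (s * β ^ 2) := fun x => by
    have e : 1 - A x * s • (1 : Matrix (Fin n) (Fin n) ℝ) =
        (1 - s • ((B x)ᵀ * B x)) + s • ((B x)ᵀ * B x - A x) := by
      rw [mul_smul_comm, Matrix.mul_one, smul_sub]
      abel
    have h₁ := norm_one_sub_smul_gram_le hβ (hB x x.2)
    rw [← hs, show β ^ 2 / (α ^ 2 + β ^ 2) = s * β ^ 2 from (one_div_mul_eq_div _ _).symm] at h₁
    have h₂ : ‖s • ((B x)ᵀ * B x - A x)‖ ≤ s * (β ^ 2 / 4) := by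
      rw [norm_smul, Real.norm_of_nonneg hs₀.le]
      exact mul_le_mul_of_nonneg_left (hdiff x).1 hs₀.le
    rw [e]
    exact (norm_add_le _ _).trans (by linarith)
  obtain ⟨X, hr, hX⟩ := hgram.newton_iterate hn (A₀ := fun x => (B x)ᵀ * B x) (m := m₂)
    (η := c * ε) (e := c₂ * ε) hβ ha₀ hZ hu hinv (fun x => (hdiff x).1) hAn hX₀ hρ
    (by
      calc _ = Z ^ 2 * ((n : ℝ) ^ 3 * (1 / 4 ^ m₂)) := by ring
        _ ≤ Z ^ 2 * (c₂ / Z ^ 2 * ε) := by gcongr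
        _ = c₂ * ε := by field_simp)
    (by
      have : c₂ ≤ 1 := min_le_right _ _
      nlinarith)
    (by
      have : c₂ ≤ c / (2 + a) := min_le_left _ _
      rw [le_div_iff₀ (by positivity)] at this
      nlinarith) K
  obtain ⟨Φ, hΦ₁, hΦ₂, hΦ₃⟩ := hX.exists_network
  refine ⟨Φ, m₁, m₂, K, hm₁, hm₂, hK, fun μ hμ => ?_, hΦ₁, hΦ₂⟩
  rw [hΦ₃ ⟨μ, hμ⟩]
  exact norm_inv_sub_le hβ hε₀ (hu ⟨μ, hμ⟩) (hinv ⟨μ, hμ⟩) (hdiff ⟨μ, hμ⟩).2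
    (norm_le_of_residual hβ (hu ⟨μ, hμ⟩) (hinv ⟨μ, hμ⟩) (hdiff ⟨μ, hμ⟩).1
      ((hr ⟨μ, hμ⟩).trans (hρ K))) ((hr ⟨μ, hμ⟩).trans hρK)

theorem mainTheorem3 (α β : ℝ) (hβ : 0 < β) (hαβ : β < α) :
    ∃ C_L C_M : ℝ, 0 < C_L ∧ 0 < C_M ∧
      ∀ (p N NI n : ℕ) (_hN : 0 < N) (_hn : 0 < n) (_hNI : NI ≤ N)
        (D : Set (Fin p → ℝ))
        (L : (Fin p → ℝ) → Matrix (Fin NI) (Fin N) ℝ)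
        (V : Matrix (Fin N) (Fin n) ℝ)
        (_hspec : SpectrumAssumption α β D (reducedMatrix L V))
        (ΦB : ℝ → ReLUNetwork p (n * N))
        (_happrox : ReLUApproximates D (reducedMatrix L V) ΦB)
        (ε : ℝ) (_hε : ε ∈ Set.Ioo (0 : ℝ) (1 / 4)),
        ∃ Φ : ReLUNetwork p (n * n),
          (∀ μ ∈ D, ‖((reducedMatrix L V μ)ᵀ * reducedMatrix L V μ)⁻¹ - matr (Φ.realize μ)‖ ≤ ε) ∧
          (Φ.numLayers : ℝ) ≤
            C_L * Real.logb 2 (Real.logb 2 (1 / ε)) * (Real.logb 2 (1 / ε) + Real.logb 2 n)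
              + C_L * Real.logb 2 N
              + (ΦB (innerAccuracy α β ε)).numLayers ∧
          (Φ.numParams : ℝ) ≤
            C_M * (n : ℝ) ^ 2 * Real.logb 2 (1 / ε) * (Real.logb 2 (Real.logb 2 (1 / ε)) + n)
                * (Real.logb 2 (1 / ε) + Real.logb 2 n)
              + C_M * N * (n : ℝ) ^ 2 * (Real.logb 2 (1 / ε) + Real.logb 2 N)
              + 8 * (ΦB (innerAccuracy α β ε)).numParams := by
  obtain ⟨C₁, C₂, C₃, hC₁, hC₂, hC₃, H⟩ := exists_inverse_network hβ hαβ
  -- The summands pay for the Gram block, the Newton steps and the output layer.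
  refine ⟨C₁ + 2 * (C₃ * C₂) + 1, 110 * C₁ + 300 * (C₃ * C₂) + 2, by positivity, by positivity,
    fun p N NI n hN hn _ D L V hspec ΦB happrox ε hε => ?_⟩
  have hacc : 0 < innerAccuracy α β ε := by
    have := hε.1
    have := hβ.trans hαβ
    unfold innerAccuracy
    positivity
  obtain ⟨Φ, m₁, m₂, K, hm₁, hm₂, hK, hΦ, hΦ₁, hΦ₂⟩ := H p N n hN hn D _ hspec ε hε
    (ΦB (innerAccuracy α β ε)) (happrox _ hacc)
  refine ⟨Φ, hΦ, ?_, ?_⟩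
  all_goals
    have hl := two_le_logb_one_div hε
    have hll := one_le_logb_logb hε
    have hll' : Real.logb 2 (Real.logb 2 (1 / ε)) ≤ Real.logb 2 (1 / ε) := by
      rw [Real.logb_le_iff_le_rpow (by norm_num) (by linarith)]
      have := one_add_mul_self_le_rpow_one_add (s := 1) (by norm_num)
        (by linarith : 1 ≤ Real.logb 2 (1 / ε))
      norm_num at this ⊢
      linarith
    have hn₁ : (1 : ℝ) ≤ n := by exact_mod_cast hn
    have hN₁ : (1 : ℝ) ≤ N := by exact_mod_cast hN
    have hln : 0 ≤ Real.logb 2 n := Real.logb_nonneg (by norm_num) hn₁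
    have hlN : 0 ≤ Real.logb 2 N := Real.logb_nonneg (by norm_num) hN₁
    set l := Real.logb 2 (1 / ε)
    set ll := Real.logb 2 l
    have hKm : (K : ℝ) * (m₂ + 2) ≤ C₃ * C₂ * (ll * (l + Real.logb 2 n)) := by
      calc (K : ℝ) * (m₂ + 2) ≤ (C₃ * ll) * (C₂ * (l + Real.logb 2 n)) := by gcongr
        _ = _ := by ring
    have hC₃₂ : 0 < C₃ * C₂ := by positivity
  · rw [hΦ₁]
    push_cast
    have h₁ : l ≤ ll * (l + Real.logb 2 n) := by nlinarith
    have h₂ : C₁ * l ≤ C₁ * (ll * (l + Real.logb 2 n)) := by gcongr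
    nlinarith [mul_nonneg hC₃₂.le hlN]
  · have hΦ₂' : (Φ.numParams : ℝ) ≤ 2 * (ΦB (innerAccuracy α β ε)).numParams +
        110 * (m₁ + 1) * (N * n ^ 2) + K * (300 * (m₂ + 1) * n ^ 3) + 2 * n ^ 2 := by
      exact_mod_cast hΦ₂
    refine hΦ₂'.trans ?_
    set MB : ℝ := ((ΦB (innerAccuracy α β ε)).numParams : ℝ)
    have hMB : 0 ≤ MB := Nat.cast_nonneg _
    set T := (n : ℝ) ^ 2 * l * (ll + n) * (l + Real.logb 2 n) with hT
    set U := (N : ℝ) * n ^ 2 * (l + Real.logb 2 N) with hU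
    have h₁ : 110 * ((m₁ : ℝ) + 1) * (N * n ^ 2) ≤ 110 * C₁ * U := by
      calc _ ≤ 110 * (C₁ * (l + Real.logb 2 N)) * (N * (n : ℝ) ^ 2) := by gcongr; linarith
        _ = _ := by ring
    -- The Newton cost n³ · ll · (l + log₂ n) fits into T because ll ≤ l.
    have h₂ : (n : ℝ) ^ 3 * (ll * (l + Real.logb 2 n)) ≤ T := by
      calc _ = (n : ℝ) ^ 2 * ll * (0 + n) * (l + Real.logb 2 n) := by ring
        _ ≤ T := by rw [hT]; gcongr; linarith
    have h₃ : (K : ℝ) * (300 * (m₂ + 1) * n ^ 3) ≤ 300 * (C₃ * C₂) * T := by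
      calc _ ≤ 300 * (n : ℝ) ^ 3 * (K * (m₂ + 2)) := by
            have : (K : ℝ) * (m₂ + 1) ≤ K * (m₂ + 2) := by gcongr; norm_num
            calc _ = 300 * (n : ℝ) ^ 3 * (K * (m₂ + 1)) := by ring
              _ ≤ _ := by gcongr
        _ ≤ 300 * (n : ℝ) ^ 3 * (C₃ * C₂ * (ll * (l + Real.logb 2 n))) := by gcongr
        _ = 300 * (C₃ * C₂) * ((n : ℝ) ^ 3 * (ll * (l + Real.logb 2 n))) := by ring
        _ ≤ _ := by gcongr
    have h₄ : (n : ℝ) ^ 2 ≤ T := by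
      calc (n : ℝ) ^ 2 = (n : ℝ) ^ 2 * 1 * (0 + 1) * (1 + 0) := by ring
        _ ≤ T := by rw [hT]; gcongr <;> linarith
    have hU₀ : 0 ≤ U := by positivity
    have hT₀ : 0 ≤ T := by positivity
    calc _ ≤ 2 * MB + 110 * C₁ * U + 300 * (C₃ * C₂) * T + 2 * T := by linarith
      _ ≤ (110 * C₁ + 300 * (C₃ * C₂) + 2) * T + (110 * C₁ + 300 * (C₃ * C₂) + 2) * U + 8 * MB := by
        nlinarith [mul_nonneg hC₁.le hT₀, mul_nonneg hC₃₂.le hU₀]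
      _ = _ := by rw [hT, hU]; ring
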